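/- \textbf{Language and semantics.} Let $\mathcal L$ be the language built from countably many propositional variables with $\wedge,\vee,\Rightarrow,\Leftarrow$ (co-implication), the unary modalities $\mathsf X,\mathsf Y,\mathsf G,\mathsf H$ and the binary modalities $\mathsf U$ (until), $\mathsf S$ (since). A \emph{flow} $(T,\sigma)$ is a set $T$ with a bijection $\sigma\colon T\to T$. A \emph{real valuation} on it is a function $V\colon\mathcal L\times T\to[0,1]$ with $V(\varphi\wedge\psi,t)=\min\{V(\varphi,t),V(\psi,t)\}$, $V(\varphi\vee\psi,t)=\max\{V(\varphi,t),V(\psi,t)\}$; $V(\varphi\Rightarrow\psi,t)=1$ if $V(\varphi,t)\le V(\psi,t)$ and $V(\psi,t)$ otherwise; $V(\varphi\Leftarrow\psi,t)=0$ if $V(\varphi,t)\le V(\psi,t)$ and $V(\varphi,t)$ otherwise; $V(\mathsf X\varphi,t)=V(\varphi,\sigma t)$, $V(\mathsf Y\varphi,t)=V(\varphi,\sigma^{-1}t)$; $V(\mathsf G\varphi,t)=\inf_{n\ge0}V(\varphi,\sigma^nt)$, $V(\mathsf H\varphi,t)=\inf_{n\ge0}V(\varphi,\sigma^{-n}t)$;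 $V(\varphi\,\mathsf U\,\psi,t)=\sup_{n\ge0}\min\{V(\varphi,\sigma^0t),\dots,V(\varphi,\sigma^{n-1}t),V(\psi,\sigma^nt)\}$; and $V(\varphi\,\mathsf S\,\psi,t)$ likewise with $\sigma^{-1}$ in place of $\sigma$. The formula $\varphi$ is \emph{falsifiable over flows} if $V(\varphi,t)\neq1$ for some flow, valuation and $t$. A \emph{bi-relational frame} consists of a linear order $(W,\le)$ and a flow $(T,\sigma)$. A \emph{valuation} on it assigns to every formula a set $[\![\varphi]\!]\subseteq W\times T$ such that $[\![p]\!]$ is downward closed in $W$ for every variable $p$; $\wedge,\vee$ are intersection and union; $(w,t)\in[\![\varphi\Rightarrow\psi]\!]$ iff for all $v\le w$, $(v,t)\in[\![\varphi]\!]$ implies $(v,t)\in[\![\psi]\!]$; $(w,t)\in[\![\varphi\Leftarrow\psi]\!]$ iff some $v\ge w$ has $(v,t)\in[\![\varphi]\!]\setminus[\![\psi]\!]$; and the modalities are interpreted as usual along $\sigma$ with $w$ fixed ($\mathsf G,\mathsf H,\mathsf U,\mathsf S$ reflexively). The formula $\varphi$ is \emph{falsifiable over bi-relational frames} if $[\![\varphi]\!]\ne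 W\times T$ for some frame and valuation. \textbf{Types and moments.} Let $\Sigma\subseteq\mathcal L$ be closed under subformulas. A \emph{$\Sigma$-type} is a set $\Phi\subseteq\Sigma$ such that, for the formulas displayed that lie in $\Sigma$: $\varphi\wedge\psi\in\Phi$ iff $\varphi,\psi\in\Phi$; $\varphi\vee\psi\in\Phi$ iff $\varphi\in\Phi$ or $\psi\in\Phi$; $\varphi\Rightarrow\psi\in\Phi$ implies $\varphi\notin\Phi$ or $\psi\in\Phi$; $\psi\in\Phi$ implies $\varphi\Rightarrow\psi\in\Phi$; $\varphi\Leftarrow\psi\in\Phi$ implies $\varphi\in\Phi$; $\varphi\in\Phi$ and $\psi\notin\Phi$ imply $\varphi\Leftarrow\psi\in\Phi$. A \emph{$\Sigma$-moment} is a finite sequence $\mathfrak m=(\mathfrak m_0,\dots,\mathfrak m_m)$ ($m\ge0$) of $\Sigma$-types with $\mathfrak m_0\supsetneq\mathfrak m_1\supsetneq\dots\supsetneq\mathfrak m_m$ such that for every $\varphi\Rightarrow\psi\in\Sigma\setminus\mathfrak m_i$ there is $j\le i$ with $\varphi\in\mathfrak m_j$, $\psi\notin\mathfrak m_j$, and for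 every $\varphi\Leftarrow\psi\in\mathfrak m_i$ there is $j\ge i$ with $\varphi\in\mathfrak m_j$, $\psi\notin\mathfrak m_j$. Put $|\mathfrak m|=\{\mathfrak m_0,\dots,\mathfrak m_m\}$, linearly ordered by index. \textbf{Relations.} A relation $R\subseteq A\times B$ between posets is \emph{convex} if images and preimages of points are convex, and \emph{fully confluent} if: $x\le x'\,R\,y'$ implies $x\,R\,y\le y'$ for some $y$; $x'\ge x\,R\,y$ implies $x'\,R\,y'\ge y$ for some $y'$; $x'\,R\,y'\ge y$ implies $x'\ge x\,R\,y$ for some $x$; $x\,R\,y\le y'$ implies $x\le x'\,R\,y'$ for some $x'$. A relation between sets of $\Sigma$-types is \emph{sensible} if each of its pairs $(\Phi,\Psi)$ satisfies, for the modal formulas displayed that lie in $\Sigma$: $\mathsf X\varphi\in\Phi$ iff $\varphi\in\Psi$; $\mathsf Y\varphi\in\Psi$ iff $\varphi\in\Phi$; $\mathsf G\varphi\in\Phi$ iff $\varphi\in\Phi$ and $\mathsf G\varphi\in\Psi$; $\mathsf H\varphi\in\Psi$ iff $\varphi\in\Psi$ and $\mathsf H\varphi\in\Phi$; $\varphi\,\mathsf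 U\,\psi\in\Phi$ iff $\psi\in\Phi$ or ($\varphi\in\Phi$ and $\varphi\,\mathsf U\,\psi\in\Psi$); $\varphi\,\mathsf S\,\psi\in\Psi$ iff $\psi\in\Psi$ or ($\varphi\in\Psi$ and $\varphi\,\mathsf S\,\psi\in\Phi$). \textbf{Witnesses.} A \emph{small falsifiability witness} for $\varphi$ (over $\Sigma$) consists of integers $i,i'\ge0$ and $l,l'\ge1$, a finite sequence of $\Sigma$-moments $\mathfrak m^{-i'-l'},\dots,\mathfrak m^{-i'},\dots,\mathfrak m^{0},\dots,\mathfrak m^{i},\dots,\mathfrak m^{i+l}$, and relations $\emptyset\ne S_k\subseteq|\mathfrak m^k|\times|\mathfrak m^{k+1}|$ for $-i'-l'\le k<i+l$, such that: (A) $\varphi\notin\Phi$ for some $\Phi\in|\mathfrak m^0|$; (B) $\mathfrak m^{-i'}=\mathfrak m^{-i'-l'}$ and $\mathfrak m^i=\mathfrak m^{i+l}$; (C) each $S_k$ is fully confluent, convex and sensible; (D) if $\Phi\in|\mathfrak m^i|$ and $\alpha\,\mathsf U\,\beta\in\Phi$, there are $r<l$ and $\Phi=\Phi_0,\dots,\Phi_r$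 with $\Phi_k\,S_{i+k}\,\Phi_{k+1}$ and $\alpha\in\Phi_k$ for $k<r$, and $\beta\in\Phi_r$; (E) if $\Phi\in|\mathfrak m^i|$ and $\mathsf G\beta\in\Sigma\setminus\Phi$, there are $r<l$ and $\Phi=\Phi_0,\dots,\Phi_r$ with $\Phi_k\,S_{i+k}\,\Phi_{k+1}$ for $k<r$, and $\beta\notin\Phi_r$; (F) if $\Phi\in|\mathfrak m^{-i'}|$ and $\alpha\,\mathsf S\,\beta\in\Phi$, there are $r<l'$ and $\Phi=\Phi_0,\dots,\Phi_r$ with $\Phi_{k+1}\,S_{-i'-k-1}\,\Phi_k$ and $\alpha\in\Phi_k$ for $k<r$, and $\beta\in\Phi_r$; (G) if $\Phi\in|\mathfrak m^{-i'}|$ and $\mathsf H\beta\in\Sigma\setminus\Phi$, there are $r<l'$ and $\Phi=\Phi_0,\dots,\Phi_r$ with $\Phi_{k+1}\,S_{-i'-k-1}\,\Phi_k$ for $k<r$, and $\beta\notin\Phi_r$. \textbf{Theorem.} Let $\varphi\in\mathcal L$ and let $\Sigma$ be any finite set of formulas closed under subformulas with $\varphi\in\Sigma$ (for example, the set of subformulas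 of $\varphi$). Then the following are equivalent: (1) $\varphi$ is falsifiable over flows; (2) $\varphi$ is falsifiable over bi-relational frames; (3) $\varphi$ has a small falsifiability witness over $\Sigma$. -/

import Mathlib

namespace GTL

/-! ### Syntax -/

/-- Formulas of the Gödel temporal language, over the propositional variables `ℕ`. -/
inductive Formula : Type where
  | var : ℕ → Formula
  | and : Formula → Formula → Formula
  | or : Formula → Formula → Formula
  /-- implication `φ ⇒ ψ` -/
  | imp : Formula → Formula → Formula
  /-- co-implication `φ ⇐ ψ` -/
  | coimp : Formula → Formula → Formula
  /-- `X φ` (next) -/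
  | X : Formula → Formula
  /-- `Y φ` (yesterday) -/
  | Y : Formula → Formula
  /-- `G φ` (going to always be) -/
  | G : Formula → Formula
  /-- `H φ` (has always been) -/
  | H : Formula → Formula
  /-- `φ U ψ` (until) -/
  | U : Formula → Formula → Formula
  /-- `φ S ψ` (since) -/
  | S : Formula → Formula → Formula

/-- The immediate subformulas of a formula. -/
def Formula.children : Formula → Set Formula
  | .var _ => ∅
  | .and φ ψ => {φ, ψ}
  | .or φ ψ => {φ, ψ}
  | .imp φ ψ => {φ, ψ}
  | .coimp φ ψ => {φ, ψ}
  | .X φ => {φ}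
  | .Y φ => {φ}
  | .G φ => {φ}
  | .H φ => {φ}
  | .U φ ψ => {φ, ψ}
  | .S φ ψ => {φ, ψ}

/-- `Sg` is closed under subformulas. -/
def SubformulaClosed (Sg : Set Formula) : Prop :=
  ∀ φ ∈ Sg, φ.children ⊆ Sg

/-! ### Real-valued semantics -/

/-- A real valuation on the flow `(T, S)`: a set `T` with a bijection `S` of `T`.
Infima and suprema are taken in the complete lattice `[0,1]`; the infimum of the empty family
is `1`. -/
structure RealValuation {T : Type*} (S : Equiv.Perm T) where
  V : Formula → T → unitInterval
  and_eq : ∀ φ ψ t, V (.and φ ψ) t = min (V φ t) (V ψ t)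
  or_eq : ∀ φ ψ t, V (.or φ ψ) t = max (V φ t) (V ψ t)
  imp_eq : ∀ φ ψ t, V (.imp φ ψ) t = if V φ t ≤ V ψ t then 1 else V ψ t
  coimp_eq : ∀ φ ψ t, V (.coimp φ ψ) t = if V φ t ≤ V ψ t then 0 else V φ t
  X_eq : ∀ φ t, V (.X φ) t = V φ (S t)
  Y_eq : ∀ φ t, V (.Y φ) t = V φ (S⁻¹ t)
  G_eq : ∀ φ t, V (.G φ) t = ⨅ n : ℕ, V φ ((S ^ n) t)
  H_eq : ∀ φ t, V (.H φ) t = ⨅ n : ℕ, V φ ((S⁻¹ ^ n) t)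
  U_eq : ∀ φ ψ t, V (.U φ ψ) t =
    ⨆ n : ℕ, min ((Finset.range n).inf fun k => V φ ((S ^ k) t)) (V ψ ((S ^ n) t))
  S_eq : ∀ φ ψ t, V (.S φ ψ) t =
    ⨆ n : ℕ, min ((Finset.range n).inf fun k => V φ ((S⁻¹ ^ k) t)) (V ψ ((S⁻¹ ^ n) t))

/-- `φ` is valid over the class of all flows. -/
def RealValid.{u} (φ : Formula) : Prop :=
  ∀ (T : Type u) (S : Equiv.Perm T) (V : RealValuation S) (t : T), V.V φ t = 1

/-- `φ` is falsifiable over the class of all flows. -/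
def RealFalsifiable.{u} (φ : Formula) : Prop := ¬ RealValid.{u} φ

/-! ### Bi-relational semantics -/

/-- The map `(w, t) ↦ (w, S t)` on `W × T`. -/
def step (W : Type*) {T : Type*} (S : Equiv.Perm T) : W × T → W × T := fun x => (x.1, S x.2)

/-- A bi-relational valuation on the frame `(W, T, ≤, S)`, where `(W, ≤)` is a linear order and
`(T, S)` is a flow. -/
structure RelValuation (W : Type*) [LinearOrder W] {T : Type*} (S : Equiv.Perm T) where
  val : Formula → Set (W × T)
  var_down : ∀ p w v t, v ≤ w → (w, t) ∈ val (.var p) → (v, t) ∈ val (.var p)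
  and_eq : ∀ φ ψ, val (.and φ ψ) = val φ ∩ val ψ
  or_eq : ∀ φ ψ, val (.or φ ψ) = val φ ∪ val ψ
  imp_eq : ∀ φ ψ, val (.imp φ ψ) = {x | ∀ v ≤ x.1, (v, x.2) ∈ val φ → (v, x.2) ∈ val ψ}
  coimp_eq : ∀ φ ψ, val (.coimp φ ψ) = {x | ∃ v ≥ x.1, (v, x.2) ∈ val φ ∧ (v, x.2) ∉ val ψ}
  X_eq : ∀ φ, val (.X φ) = step W S ⁻¹' val φ
  Y_eq : ∀ φ, val (.Y φ) = step W S '' val φ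
  G_eq : ∀ φ, val (.G φ) = ⋂ n : ℕ, (step W S)^[n] ⁻¹' val φ
  H_eq : ∀ φ, val (.H φ) = ⋂ n : ℕ, (step W S)^[n] '' val φ
  U_eq : ∀ φ ψ, val (.U φ ψ) =
    ⋃ n : ℕ, (⋂ k < n, (step W S)^[k] ⁻¹' val φ) ∩ (step W S)^[n] ⁻¹' val ψ
  S_eq : ∀ φ ψ, val (.S φ ψ) =
    ⋃ n : ℕ, (⋂ k < n, (step W S)^[k] '' val φ) ∩ (step W S)^[n] '' val ψ

/-- `φ` is valid over the class of all bi-relational frames. -/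
def RelValid.{u, v} (φ : Formula) : Prop :=
  ∀ (W : Type u) [LinearOrder W] (T : Type v) (S : Equiv.Perm T) (V : RelValuation W S),
    V.val φ = Set.univ

/-- `φ` is falsifiable over the class of all bi-relational frames. -/
def RelFalsifiable.{u, v} (φ : Formula) : Prop := ¬ RelValid.{u, v} φ

/-! ### Types, sensible pairs, confluent and convex relations -/

/-- `Φ` is an `Sg`-type. -/
structure IsType (Sg Φ : Set Formula) : Prop where
  subset : Φ ⊆ Sg
  and_iff : ∀ φ ψ, Formula.and φ ψ ∈ Sg → (Formula.and φ ψ ∈ Φ ↔ φ ∈ Φ ∧ ψ ∈ Φ)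
  or_iff : ∀ φ ψ, Formula.or φ ψ ∈ Sg → (Formula.or φ ψ ∈ Φ ↔ φ ∈ Φ ∨ ψ ∈ Φ)
  imp_elim : ∀ φ ψ, Formula.imp φ ψ ∈ Sg → Formula.imp φ ψ ∈ Φ → φ ∉ Φ ∨ ψ ∈ Φ
  imp_intro : ∀ φ ψ, Formula.imp φ ψ ∈ Sg → ψ ∈ Φ → Formula.imp φ ψ ∈ Φ
  coimp_elim : ∀ φ ψ, Formula.coimp φ ψ ∈ Sg → Formula.coimp φ ψ ∈ Φ → φ ∈ Φ
  coimp_intro : ∀ φ ψ, Formula.coimp φ ψ ∈ Sg → φ ∈ Φ → ψ ∉ Φ → Formula.coimp φ ψ ∈ Φ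

/-- The ordered pair `(Φ, Ψ)` of `Sg`-types is sensible. -/
structure Sensible (Sg Φ Ψ : Set Formula) : Prop where
  X_iff : ∀ φ, Formula.X φ ∈ Sg → (Formula.X φ ∈ Φ ↔ φ ∈ Ψ)
  Y_iff : ∀ φ, Formula.Y φ ∈ Sg → (Formula.Y φ ∈ Ψ ↔ φ ∈ Φ)
  G_iff : ∀ φ, Formula.G φ ∈ Sg → (Formula.G φ ∈ Φ ↔ φ ∈ Φ ∧ Formula.G φ ∈ Ψ)
  H_iff : ∀ φ, Formula.H φ ∈ Sg → (Formula.H φ ∈ Ψ ↔ φ ∈ Ψ ∧ Formula.H φ ∈ Φ)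
  U_iff : ∀ φ ψ, Formula.U φ ψ ∈ Sg →
    (Formula.U φ ψ ∈ Φ ↔ ψ ∈ Φ ∨ (φ ∈ Φ ∧ Formula.U φ ψ ∈ Ψ))
  S_iff : ∀ φ ψ, Formula.S φ ψ ∈ Sg →
    (Formula.S φ ψ ∈ Ψ ↔ ψ ∈ Ψ ∨ (φ ∈ Ψ ∧ Formula.S φ ψ ∈ Φ))

/-- A relation between posets is convex: all images and preimages of points are convex. -/
structure ConvexRel {A B : Type*} [PartialOrder A] [PartialOrder B] (R : A → B → Prop) :
    Prop where
  image : ∀ a, Set.OrdConnected {b | R a b}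
  preimage : ∀ b, Set.OrdConnected {a | R a b}

/-- A relation between posets is fully confluent. -/
structure FullyConfluent {A B : Type*} [PartialOrder A] [PartialOrder B] (R : A → B → Prop) :
    Prop where
  forth_down : ∀ x x' y', x ≤ x' → R x' y' → ∃ y, R x y ∧ y ≤ y'
  forth_up : ∀ x x' y, x ≤ x' → R x y → ∃ y', R x' y' ∧ y ≤ y'
  back_down : ∀ x' y y', R x' y' → y ≤ y' → ∃ x, x ≤ x' ∧ R x y
  back_up : ∀ x y y', R x y → y ≤ y' → ∃ x', x ≤ x' ∧ R x' y'

/-! ### Moments and small falsifiability witnesses -/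

/-- An `Sg`-moment `(𝔪₀, …, 𝔪ₘ)` with `m = top` and `𝔪ᵢ = lab i`. -/
structure Moment (Sg : Set Formula) where
  top : ℕ
  lab : Fin (top + 1) → Set Formula
  isType : ∀ i, IsType Sg (lab i)
  strict : ∀ i j, i < j → lab j ⊂ lab i
  imp_defect : ∀ i φ ψ, Formula.imp φ ψ ∈ Sg \ lab i → ∃ j ≤ i, φ ∈ lab j ∧ ψ ∉ lab j
  coimp_defect : ∀ i φ ψ, Formula.coimp φ ψ ∈ lab i → ∃ j ≥ i, φ ∈ lab j ∧ ψ ∉ lab j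

/-- The set `|𝔪| = {𝔪₀, …, 𝔪ₘ}` of types of a moment. -/
def Moment.carrier {Sg : Set Formula} (m : Moment Sg) : Set (Set Formula) := Set.range m.lab

/-- `R` is a nonempty, fully confluent, convex and sensible relation `R ⊆ |𝔪| × |𝔫|`.
The elements of `|𝔪|` and `|𝔫|` are linearly ordered by their (unique) indices. -/
structure IsTemporalStep {Sg : Set Formula} (m n : Moment Sg)
    (R : Set Formula → Set Formula → Prop) : Prop where
  subset : ∀ Φ Ψ, R Φ Ψ → Φ ∈ m.carrier ∧ Ψ ∈ n.carrier
  nonempty : ∃ Φ Ψ, R Φ Ψ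
  confluent : FullyConfluent fun a b => R (m.lab a) (n.lab b)
  convex : ConvexRel fun a b => R (m.lab a) (n.lab b)
  sensible : ∀ Φ Ψ, R Φ Ψ → Sensible Sg Φ Ψ

/-- A small falsifiability witness for `φ`, made of `Sg`-moments: a finite sequence
`𝔪^{-i'-l'}, …, 𝔪^{-i'}, …, 𝔪^0, …, 𝔪^i, …, 𝔪^{i+l}` of moments (`mom`), with relations
`rel k ⊆ |𝔪^k| × |𝔪^{k+1}|` for `-i'-l' ≤ k < i+l`, where `i, i' ≥ 0` and `l, l' ≥ 1`.
A path of indices `(j_k)_{k ≤ r}` is given as the path `P k` of the corresponding types;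
only the values `P 0, …, P r` matter. -/
structure SmallWitness (Sg : Set Formula) (φ : Formula) where
  i' : ℕ
  i : ℕ
  l' : ℕ
  l : ℕ
  l'_pos : 0 < l'
  l_pos : 0 < l
  mom : Set.Icc (-(i' : ℤ) - l') (i + l) → Moment Sg
  rel : Set.Ico (-(i' : ℤ) - l') (i + l) → Set Formula → Set Formula → Prop
  /-- `φ` is falsified in the moment at position `0`. -/
  falsifies : ∃ Φ ∈ (mom ⟨0, by constructor <;> omega⟩).carrier, φ ∉ Φ
  /-- Repetition at the ends of the past loop and of the future loop. -/
  past_loop : mom ⟨-i', by constructor <;> omega⟩ = mom ⟨-i' - l', by constructor <;> omega⟩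
  future_loop : mom ⟨i, by constructor <;> omega⟩ = mom ⟨i + l, by constructor <;> omega⟩
  step : ∀ (k : ℤ) (h₁ : -(i' : ℤ) - l' ≤ k) (h₂ : k < i + l),
    IsTemporalStep (mom ⟨k, h₁, h₂.le⟩) (mom ⟨k + 1, by constructor <;> omega⟩) (rel ⟨k, h₁, h₂⟩)
  /-- Every until-formula at position `i` is realised within the future loop. -/
  until_realised : ∀ Φ ∈ (mom ⟨i, by constructor <;> omega⟩).carrier, ∀ α β, Formula.U α β ∈ Φ →
    ∃ (r : ℕ) (hr : r < l) (P : ℕ → Set Formula), P 0 = Φ ∧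
      (∀ (k : ℕ) (hk : k < r),
        rel ⟨i + k, by constructor <;> omega⟩ (P k) (P (k + 1)) ∧ α ∈ P k) ∧
      β ∈ P r
  /-- Every `G`-defect at position `i` is realised within the future loop. -/
  G_realised : ∀ Φ ∈ (mom ⟨i, by constructor <;> omega⟩).carrier, ∀ β, Formula.G β ∈ Sg \ Φ →
    ∃ (r : ℕ) (hr : r < l) (P : ℕ → Set Formula), P 0 = Φ ∧
      (∀ (k : ℕ) (hk : k < r), rel ⟨i + k, by constructor <;> omega⟩ (P k) (P (k + 1))) ∧
      β ∉ P r
  /-- Every since-formula at position `-i'` is realised within the past loop. -/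
  since_realised : ∀ Φ ∈ (mom ⟨-i', by constructor <;> omega⟩).carrier, ∀ α β,
    Formula.S α β ∈ Φ →
    ∃ (r : ℕ) (hr : r < l') (P : ℕ → Set Formula), P 0 = Φ ∧
      (∀ (k : ℕ) (hk : k < r),
        rel ⟨-i' - k - 1, by constructor <;> omega⟩ (P (k + 1)) (P k) ∧ α ∈ P k) ∧
      β ∈ P r
  /-- Every `H`-defect at position `-i'` is realised within the past loop. -/
  H_realised : ∀ Φ ∈ (mom ⟨-i', by constructor <;> omega⟩).carrier, ∀ β,
    Formula.H β ∈ Sg \ Φ →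
    ∃ (r : ℕ) (hr : r < l') (P : ℕ → Set Formula), P 0 = Φ ∧
      (∀ (k : ℕ) (hk : k < r), rel ⟨-i' - k - 1, by constructor <;> omega⟩ (P (k + 1)) (P k)) ∧
      β ∉ P r

end GTL

universe u v w

namespace GTL

/-! All three conditions are compared with one object, the `TypeFlow`: a linear order whose points
carry, at each integer time, a type that shrinks as the point grows, with sensible passage from each
time to the next. A bi-relational model yields one along an orbit by collecting the formulas true at
each point. A real model yields one over the thresholds in (0,1]: the type at `r` consists of the
formulas of value at least `r`.

From model to witness. As `Sg` is finite, the types at one time form a finite chain, hence a moment,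
and only finitely many such chains exist. Some chain recurs infinitely often in the future and some
chain in the past, so the loops can be made long enough to meet every eventuality owed where they
start (`TypeFlow.nonempty_smallWitness`). The relations between consecutive moments are confluent
and convex because they come from two antitone maps on the same linear order (`isTemporalStep_rel`).

From witness to model. Repeating the loops gives a bi-infinite sequence of moments, and the points
of the new model are paths (threads) through it. They must be linearly ordered, pass through every
type of every moment, and each fulfil its own eventualities. Confluence and convexity allow crossing
pairs to be uncrossed (`IsTemporalStep.uncross`), so the pointwise minimum and maximum of two
threads are threads. However, two fulfilling threads may cross infinitely often, and then their
minimum may fulfil nothing. The repair (`IsGood.of_mixture`) is to stay on one of them from a common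
point on; if they never meet again, the mixture already follows the other. Good threads are thereby
inserted one at a time into a finite chain, giving a countable chain through all types
(`exists_countable_chain`), and a truth lemma (`mem_relValuation_iff`) turns it into a bi-relational
model.

Countability leads back to [0,1]: give every point of the order positive mass, with total mass 1,
and let the value of a formula be the mass of its truth set, up to an order isomorphism
(`exists_weight`). Truth sets are lower sets of a linear order, hence nested, and the real clauses
follow from monotonicity and continuity of measure. -/

/-! ### Eventualities -/

/-- The eventuality `o` (an until-formula, or the failure of a `G`-formula) is owed at `Φ`. -/
def FuturePending (Sg : Set Formula) : Formula → Set Formula → Prop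
  | .U α β, Φ => .U α β ∈ Φ
  | .G β, Φ => .G β ∈ Sg \ Φ
  | _, _ => False

/-- The eventuality `o` (a since-formula, or the failure of an `H`-formula) is owed at `Φ`. -/
def PastPending (Sg : Set Formula) : Formula → Set Formula → Prop
  | .S α β, Φ => .S α β ∈ Φ
  | .H β, Φ => .H β ∈ Sg \ Φ
  | _, _ => False

/-- What has to hold at `Φ` as long as the eventuality `o` is not yet fulfilled. -/
def Holding : Formula → Set Formula → Prop
  | .U α _, Φ => α ∈ Φ
  | .S α _, Φ => α ∈ Φ
  | _, _ => True

/-- The eventuality `o` is fulfilled at `Φ`. -/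
def Fulfilled : Formula → Set Formula → Prop
  | .U _ β, Φ => β ∈ Φ
  | .G β, Φ => β ∉ Φ
  | .S _ β, Φ => β ∈ Φ
  | .H β, Φ => β ∉ Φ
  | _, _ => True

theorem FuturePending.mem {Sg Φ : Set Formula} (hΦ : Φ ⊆ Sg) {o : Formula}
    (h : FuturePending Sg o Φ) : o ∈ Sg := by
  cases o with
  | U α β => exact hΦ h
  | G β => exact h.1
  | _ => exact h.elim

theorem PastPending.mem {Sg Φ : Set Formula} (hΦ : Φ ⊆ Sg) {o : Formula}
    (h : PastPending Sg o Φ) : o ∈ Sg := by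
  cases o with
  | S α β => exact hΦ h
  | H β => exact h.1
  | _ => exact h.elim

/-- The `U` and `G` clauses of `Sensible`, read as one statement: a debt is paid now or passed on.
This is all that the later combinatorics needs to know about the modalities. -/
theorem FuturePending.persist {Sg Φ Ψ : Set Formula} (hΦ : Φ ⊆ Sg) (hs : Sensible Sg Φ Ψ)
    {o : Formula} (h : FuturePending Sg o Φ) :
    Fulfilled o Φ ∨ (Holding o Φ ∧ FuturePending Sg o Ψ) := by
  cases o with
  | U α β => exact (hs.U_iff α β (hΦ h)).1 h
  | G β =>
    have := hs.G_iff β h.1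
    by_cases hβ : β ∈ Φ
    · exact .inr ⟨trivial, h.1, fun hG => h.2 (this.2 ⟨hβ, hG⟩)⟩
    · exact .inl hβ
  | _ => exact h.elim

theorem PastPending.persist {Sg Φ Ψ : Set Formula} (hΨ : Ψ ⊆ Sg) (hs : Sensible Sg Φ Ψ)
    {o : Formula} (h : PastPending Sg o Ψ) :
    Fulfilled o Ψ ∨ (Holding o Ψ ∧ PastPending Sg o Φ) := by
  cases o with
  | S α β => exact (hs.S_iff α β (hΨ h)).1 h
  | H β =>
    have := hs.H_iff β h.1
    by_cases hβ : β ∈ Ψ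
    · exact .inr ⟨trivial, h.1, fun hG => h.2 (this.2 ⟨hβ, hG⟩)⟩
    · exact .inl hβ
  | _ => exact h.elim

/-! ### Flows of types -/

/-- A linear order `W` in which each point carries a bi-infinite sensible sequence of types,
antitone in the point and without defects for the two implications. -/
structure TypeFlow (Sg : Set Formula) (W : Type*) [LinearOrder W] where
  ty : ℤ → W → Set Formula
  anti : ∀ k, Antitone (ty k)
  isType : ∀ k w, IsType Sg (ty k w)
  imp_defect : ∀ k w φ ψ, Formula.imp φ ψ ∈ Sg \ ty k w → ∃ v ≤ w, φ ∈ ty k v ∧ ψ ∉ ty k v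
  coimp_defect : ∀ k w φ ψ, Formula.coimp φ ψ ∈ ty k w → ∃ v ≥ w, φ ∈ ty k v ∧ ψ ∉ ty k v
  sensible : ∀ k w, Sensible Sg (ty k w) (ty (k + 1) w)

namespace TypeFlow

variable {Sg : Set Formula} {W : Type*} [LinearOrder W] (F : TypeFlow Sg W)

/-- From `(k, w)` on, the future eventuality `o` is fulfilled in finitely many steps. -/
def FutureRealises (o : Formula) (k : ℤ) (w : W) : Prop :=
  ∃ r : ℕ, (∀ j < r, Holding o (F.ty (k + j) w)) ∧ Fulfilled o (F.ty (k + r) w)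

/-- From `(k, w)` backwards, the past eventuality `o` is fulfilled in finitely many steps. -/
def PastRealises (o : Formula) (k : ℤ) (w : W) : Prop :=
  ∃ r : ℕ, (∀ j < r, Holding o (F.ty (k - j) w)) ∧ Fulfilled o (F.ty (k - r) w)

/-- Each eventuality owed at `(k, w)` is realised by a point with the same type at `k`. -/
structure Realising : Prop where
  future : ∀ o k w, FuturePending Sg o (F.ty k w) →
    ∃ v, F.ty k v = F.ty k w ∧ F.FutureRealises o k v
  past : ∀ o k w, PastPending Sg o (F.ty k w) →
    ∃ v, F.ty k v = F.ty k w ∧ F.PastRealises o k v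

end TypeFlow

/-! ### Bi-relational models as flows of types -/

theorem step_iterate {W T : Type*} (S : Equiv.Perm T) (n : ℕ) (w : W) (t : T) :
    (step W S)^[n] (w, t) = (w, (S ^ n) t) := by
  induction n generalizing t with
  | zero => rfl
  | succ n ih => rw [Function.iterate_succ_apply, step, ih, pow_succ, Equiv.Perm.mul_apply]

/-- The past modalities are stated with images; since `S` is a bijection, these become membership at
`S⁻¹ ^ n`. -/
theorem mem_image_step_iterate {W T : Type*} (S : Equiv.Perm T) (n : ℕ) (w : W) (t : T)
    (A : Set (W × T)) : (w, t) ∈ (step W S)^[n] '' A ↔ (w, (S⁻¹ ^ n) t) ∈ A := by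
  constructor
  · rintro ⟨⟨v, s⟩, h, he⟩
    rw [step_iterate, Prod.mk.injEq] at he
    obtain ⟨rfl, rfl⟩ := he
    rwa [← Equiv.Perm.mul_apply, inv_pow, inv_mul_cancel, Equiv.Perm.one_apply]
  · intro h
    refine ⟨_, h, ?_⟩
    rw [step_iterate, ← Equiv.Perm.mul_apply, inv_pow, mul_inv_cancel, Equiv.Perm.one_apply]

theorem mem_image_step {W T : Type*} (S : Equiv.Perm T) (w : W) (t : T)
    (A : Set (W × T)) : (w, t) ∈ step W S '' A ↔ (w, S⁻¹ t) ∈ A := by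
  simpa using mem_image_step_iterate S 1 w t A

namespace RelValuation

variable {W : Type*} [LinearOrder W] {T : Type*} {S : Equiv.Perm T} (V : RelValuation W S)
include V

theorem mem_X {φ w t} : (w, t) ∈ V.val (.X φ) ↔ (w, S t) ∈ V.val φ := by
  rw [V.X_eq]; rfl

theorem mem_Y {φ w t} : (w, t) ∈ V.val (.Y φ) ↔ (w, S⁻¹ t) ∈ V.val φ := by
  rw [V.Y_eq, mem_image_step]

theorem mem_G {φ w t} : (w, t) ∈ V.val (.G φ) ↔ ∀ n : ℕ, (w, (S ^ n) t) ∈ V.val φ := by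
  simp [V.G_eq, step_iterate]

theorem mem_H {φ w t} : (w, t) ∈ V.val (.H φ) ↔ ∀ n : ℕ, (w, (S⁻¹ ^ n) t) ∈ V.val φ := by
  rw [V.H_eq, Set.mem_iInter]
  exact forall_congr' fun n => mem_image_step_iterate ..

theorem mem_U {φ ψ w t} : (w, t) ∈ V.val (.U φ ψ) ↔
    ∃ n : ℕ, (∀ k < n, (w, (S ^ k) t) ∈ V.val φ) ∧ (w, (S ^ n) t) ∈ V.val ψ := by
  simp [V.U_eq, step_iterate]

theorem mem_S {φ ψ w t} : (w, t) ∈ V.val (.S φ ψ) ↔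
    ∃ n : ℕ, (∀ k < n, (w, (S⁻¹ ^ k) t) ∈ V.val φ) ∧ (w, (S⁻¹ ^ n) t) ∈ V.val ψ := by
  simp only [V.S_eq, Set.mem_iUnion, Set.mem_inter_iff, Set.mem_iInter, mem_image_step_iterate]

theorem down {φ : Formula} {v w : W} {t : T} (hvw : v ≤ w) (h : (w, t) ∈ V.val φ) :
    (v, t) ∈ V.val φ := by
  induction φ generalizing t with
  | var p => exact V.var_down p w v t hvw h
  | and φ ψ ihφ ihψ => rw [V.and_eq] at h ⊢; exact ⟨ihφ h.1, ihψ h.2⟩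
  | or φ ψ ihφ ihψ => rw [V.or_eq] at h ⊢; exact h.imp ihφ ihψ
  | imp φ ψ => rw [V.imp_eq] at h ⊢; exact fun u hu => h u (hu.trans hvw)
  | coimp φ ψ =>
    rw [V.coimp_eq] at h ⊢
    obtain ⟨u, hu, h⟩ := h
    exact ⟨u, hvw.trans hu, h⟩
  | X φ ih => rw [V.mem_X] at h ⊢; exact ih h
  | Y φ ih => rw [V.mem_Y] at h ⊢; exact ih h
  | G φ ih => rw [V.mem_G] at h ⊢; exact fun n => ih (h n)
  | H φ ih => rw [V.mem_H] at h ⊢; exact fun n => ih (h n)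
  | U φ ψ ihφ ihψ =>
    rw [V.mem_U] at h ⊢
    obtain ⟨n, h₁, h₂⟩ := h
    exact ⟨n, fun k hk => ihφ (h₁ k hk), ihψ h₂⟩
  | S φ ψ ihφ ihψ =>
    rw [V.mem_S] at h ⊢
    obtain ⟨n, h₁, h₂⟩ := h
    exact ⟨n, fun k hk => ihφ (h₁ k hk), ihψ h₂⟩

end RelValuation

theorem forall_nat_iff_zero_and_succ {p : ℕ → Prop} : (∀ n, p n) ↔ p 0 ∧ ∀ n, p (n + 1) :=
  ⟨fun h => ⟨h 0, fun n => h (n + 1)⟩, fun h n => by cases n; exacts [h.1, h.2 _]⟩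

/-- The fixed-point equation of reflexive until, which is exactly the shape of the `U` and `S`
clauses of `Sensible`. -/
theorem until_nat_unfold {p q : ℕ → Prop} : (∃ n, (∀ k < n, p k) ∧ q n) ↔
    q 0 ∨ (p 0 ∧ ∃ n, (∀ k < n, p (k + 1)) ∧ q (n + 1)) := by
  constructor
  · rintro ⟨_ | n, h₁, h₂⟩
    · exact .inl h₂
    · exact .inr ⟨h₁ 0 n.succ_pos, n, fun k hk => h₁ _ (by omega), h₂⟩
  · rintro (h | ⟨h₀, n, h₁, h₂⟩)
    · exact ⟨0, by simp, h⟩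
    · refine ⟨n + 1, fun k hk => ?_, h₂⟩
      cases k
      exacts [h₀, h₁ _ (by omega)]

theorem perm_pow_succ_apply {T : Type*} (S : Equiv.Perm T) (n : ℕ) (t : T) :
    (S ^ (n + 1)) t = (S ^ n) (S t) := by
  rw [pow_succ, Equiv.Perm.mul_apply]

theorem perm_inv_pow_succ_apply {T : Type*} (S : Equiv.Perm T) (n : ℕ) (t : T) :
    (S⁻¹ ^ (n + 1)) (S t) = (S⁻¹ ^ n) t := by
  rw [pow_succ, Equiv.Perm.mul_apply, ← Equiv.Perm.mul_apply S⁻¹, inv_mul_cancel,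
    Equiv.Perm.one_apply]

theorem perm_zpow_add_one_apply {T : Type*} (S : Equiv.Perm T) (k : ℤ) (t : T) :
    (S ^ (k + 1)) t = S ((S ^ k) t) := by
  rw [add_comm, zpow_add, zpow_one, Equiv.Perm.mul_apply]

theorem perm_pow_zpow_apply {T : Type*} (S : Equiv.Perm T) (k : ℤ) (n : ℕ) (t : T) :
    (S ^ n) ((S ^ k) t) = (S ^ (k + n)) t := by
  rw [add_comm, zpow_add, zpow_natCast, Equiv.Perm.mul_apply]

theorem perm_inv_pow_zpow_apply {T : Type*} (S : Equiv.Perm T) (k : ℤ) (n : ℕ) (t : T) :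
    (S⁻¹ ^ n) ((S ^ k) t) = (S ^ (k - n)) t := by
  rw [sub_eq_add_neg, add_comm, zpow_add, zpow_neg, zpow_natCast, Equiv.Perm.mul_apply, inv_pow]

namespace RelValuation

variable {W : Type*} [LinearOrder W] {T : Type*} {S : Equiv.Perm T} (V : RelValuation W S)

/-- The set of formulas of `Sg` that are true at `(w, t)`. -/
def typeAt (Sg : Set Formula) (t : T) (w : W) : Set Formula := {ψ ∈ Sg | (w, t) ∈ V.val ψ}

theorem sensible_typeAt {Sg : Set Formula} (hsub : SubformulaClosed Sg) (t : T) (w : W) :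
    Sensible Sg (V.typeAt Sg t w) (V.typeAt Sg (S t) w) where
  X_iff φ h := by
    have h₁ : φ ∈ Sg := hsub _ h (by simp [Formula.children])
    simp [typeAt, h, h₁, V.mem_X]
  Y_iff φ h := by
    have h₁ : φ ∈ Sg := hsub _ h (by simp [Formula.children])
    simp [typeAt, h, h₁, V.mem_Y]
  G_iff φ h := by
    have h₁ : φ ∈ Sg := hsub _ h (by simp [Formula.children])
    simp only [typeAt, Set.mem_sep_iff, h, h₁, V.mem_G, true_and]
    rw [forall_nat_iff_zero_and_succ]
    simp only [perm_pow_succ_apply, pow_zero, Equiv.Perm.one_apply]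
  H_iff φ h := by
    have h₁ : φ ∈ Sg := hsub _ h (by simp [Formula.children])
    simp only [typeAt, Set.mem_sep_iff, h, h₁, V.mem_H, true_and]
    rw [forall_nat_iff_zero_and_succ]
    simp only [perm_inv_pow_succ_apply, pow_zero, Equiv.Perm.one_apply]
  U_iff φ ψ h := by
    have h₁ : φ ∈ Sg := hsub _ h (by simp [Formula.children])
    have h₂ : ψ ∈ Sg := hsub _ h (by simp [Formula.children])
    simp only [typeAt, Set.mem_sep_iff, h, h₁, h₂, V.mem_U, true_and]
    rw [until_nat_unfold]
    simp only [perm_pow_succ_apply, pow_zero, Equiv.Perm.one_apply]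
  S_iff φ ψ h := by
    have h₁ : φ ∈ Sg := hsub _ h (by simp [Formula.children])
    have h₂ : ψ ∈ Sg := hsub _ h (by simp [Formula.children])
    simp only [typeAt, Set.mem_sep_iff, h, h₁, h₂, V.mem_S, true_and]
    rw [until_nat_unfold]
    simp only [perm_inv_pow_succ_apply, pow_zero, Equiv.Perm.one_apply]

theorem isType_typeAt {Sg : Set Formula} (hsub : SubformulaClosed Sg) (t : T) (w : W) :
    IsType Sg (V.typeAt Sg t w) where
  subset := Set.sep_subset _ _
  and_iff φ ψ h := by
    have h₁ : φ ∈ Sg := hsub _ h (by simp [Formula.children])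
    have h₂ : ψ ∈ Sg := hsub _ h (by simp [Formula.children])
    simp [typeAt, h, h₁, h₂, V.and_eq]
  or_iff φ ψ h := by
    have h₁ : φ ∈ Sg := hsub _ h (by simp [Formula.children])
    have h₂ : ψ ∈ Sg := hsub _ h (by simp [Formula.children])
    simp [typeAt, h, h₁, h₂, V.or_eq]
  imp_elim φ ψ h hm := by
    have h₂ : ψ ∈ Sg := hsub _ h (by simp [Formula.children])
    have := hm.2
    rw [V.imp_eq] at this
    by_cases hφ : φ ∈ V.typeAt Sg t w
    · exact .inr ⟨h₂, this w le_rfl hφ.2⟩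
    · exact .inl hφ
  imp_intro φ ψ h hm := ⟨h, by rw [V.imp_eq]; exact fun v hv _ => V.down hv hm.2⟩
  coimp_elim φ ψ h hm := by
    have h₁ : φ ∈ Sg := hsub _ h (by simp [Formula.children])
    have := hm.2
    rw [V.coimp_eq] at this
    obtain ⟨v, hv, hvφ, -⟩ := this
    exact ⟨h₁, V.down hv hvφ⟩
  coimp_intro φ ψ h hφ hψ := by
    have h₂ : ψ ∈ Sg := hsub _ h (by simp [Formula.children])
    refine ⟨h, ?_⟩
    rw [V.coimp_eq]
    exact ⟨w, le_rfl, hφ.2, fun h' => hψ ⟨h₂, h'⟩⟩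

/-- The flow of types along the orbit of `t`. -/
def typeFlow {Sg : Set Formula} (hsub : SubformulaClosed Sg) (t : T) : TypeFlow Sg W where
  ty k w := V.typeAt Sg ((S ^ k) t) w
  anti _ _ _ h _ hψ := ⟨hψ.1, V.down h hψ.2⟩
  isType _ _ := V.isType_typeAt hsub _ _
  imp_defect k w φ ψ h := by
    have h₁ : φ ∈ Sg := hsub _ h.1 (by simp [Formula.children])
    have := h.2
    simp only [typeAt, h.1, true_and, V.imp_eq, Set.mem_ofPred_eq] at this
    push Not at this
    obtain ⟨v, hv, hφ, hψ⟩ := this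
    exact ⟨v, hv, ⟨h₁, hφ⟩, fun h' => hψ h'.2⟩
  coimp_defect k w φ ψ h := by
    have h₁ : φ ∈ Sg := hsub _ h.1 (by simp [Formula.children])
    have := h.2
    simp only [V.coimp_eq, Set.mem_ofPred_eq] at this
    obtain ⟨v, hv, hφ, hψ⟩ := this
    exact ⟨v, hv, ⟨h₁, hφ⟩, fun h' => hψ h'.2⟩
  sensible k w := by
    rw [perm_zpow_add_one_apply]
    exact V.sensible_typeAt hsub _ _

theorem typeFlow_realising {Sg : Set Formula} (hsub : SubformulaClosed Sg) (t : T) :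
    (V.typeFlow hsub t).Realising where
  future o k w h := by
    refine ⟨w, rfl, ?_⟩
    cases o with
    | U α β =>
      have h₁ : α ∈ Sg := hsub _ h.1 (by simp [Formula.children])
      have h₂ : β ∈ Sg := hsub _ h.1 (by simp [Formula.children])
      have := V.mem_U.1 h.2
      simp only [perm_pow_zpow_apply] at this
      obtain ⟨r, hα, hβ⟩ := this
      exact ⟨r, fun j hj => ⟨h₁, hα j hj⟩, h₂, hβ⟩
    | G β =>
      have : ¬ ∀ n : ℕ, (w, (S ^ n) ((S ^ k) t)) ∈ V.val β := fun h' => h.2 ⟨h.1, V.mem_G.2 h'⟩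
      push Not at this
      simp only [perm_pow_zpow_apply] at this
      obtain ⟨r, hβ⟩ := this
      exact ⟨r, fun j hj => trivial, fun h' => hβ h'.2⟩
    | _ => exact h.elim
  past o k w h := by
    refine ⟨w, rfl, ?_⟩
    cases o with
    | S α β =>
      have h₁ : α ∈ Sg := hsub _ h.1 (by simp [Formula.children])
      have h₂ : β ∈ Sg := hsub _ h.1 (by simp [Formula.children])
      have := V.mem_S.1 h.2
      simp only [perm_inv_pow_zpow_apply] at this
      obtain ⟨r, hα, hβ⟩ := this
      exact ⟨r, fun j hj => ⟨h₁, hα j hj⟩, h₂, hβ⟩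
    | H β =>
      have : ¬ ∀ n : ℕ, (w, (S⁻¹ ^ n) ((S ^ k) t)) ∈ V.val β := fun h' => h.2 ⟨h.1, V.mem_H.2 h'⟩
      push Not at this
      simp only [perm_inv_pow_zpow_apply] at this
      obtain ⟨r, hβ⟩ := this
      exact ⟨r, fun j hj => trivial, fun h' => hβ h'.2⟩
    | _ => exact h.elim

end RelValuation

/-! ### Real models as flows of types -/

/-- By density, `r'` can be put between `r` and the largest member of `s` below `r`. Adding 0 to `s`
keeps `r'` positive. -/
theorem exists_lt_separating {s : Set unitInterval} (hs : s.Finite) {r : unitInterval}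
    (hr : 0 < r) : ∃ r' < r, 0 < r' ∧ ∀ x ∈ s, x < r → x < r' := by
  obtain ⟨m, ⟨hm, hmr⟩, hmax⟩ := Set.exists_max_image (insert 0 s ∩ Set.Iio r) id
    ((hs.insert 0).inter_of_left _) ⟨0, Set.mem_insert _ _, hr⟩
  obtain ⟨r', h₁, h₂⟩ := exists_between (show m < r from hmr)
  exact ⟨r', h₂, (hmax 0 ⟨Set.mem_insert _ _, hr⟩).trans_lt h₁,
    fun x hx hxr => (hmax x ⟨Set.mem_insert_of_mem _ hx, hxr⟩).trans_lt h₁⟩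

namespace RealValuation

variable {T : Type*} {S : Equiv.Perm T} (V : RealValuation S)

theorem G_step (φ : Formula) (t : T) : V.V (.G φ) t = min (V.V φ t) (V.V (.G φ) (S t)) := by
  rw [V.G_eq, V.G_eq, ← inf_iInf_nat_succ]
  simp only [perm_pow_succ_apply, pow_zero, Equiv.Perm.one_apply]

theorem H_step (φ : Formula) (t : T) : V.V (.H φ) (S t) = min (V.V φ (S t)) (V.V (.H φ) t) := by
  rw [V.H_eq, V.H_eq, ← inf_iInf_nat_succ]
  simp only [perm_inv_pow_succ_apply, pow_zero, Equiv.Perm.one_apply]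

/-- The quantitative form of `until_nat_unfold`: the common factor `f 0` leaves the supremum because
binary minima distribute over arbitrary suprema. -/
theorem iSup_until_unfold (f g : ℕ → unitInterval) :
    ⨆ n : ℕ, min ((Finset.range n).inf f) (g n) =
      max (g 0) (min (f 0) (⨆ n : ℕ, min ((Finset.range n).inf fun k => f (k + 1)) (g (n + 1)))) := by
  have h (n : ℕ) : (Finset.range (n + 1)).inf f =
      f 0 ⊓ (Finset.range n).inf fun k => f (k + 1) := by
    rw [Finset.range_eq_Ico, Finset.range_eq_Ico, ← Finset.insert_Ico_add_one_left_eq_Ico (by simp),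
      Finset.inf_insert, ← Finset.map_add_right_Ico 0 n 1, Finset.inf_map]
    rfl
  rw [← sup_iSup_nat_succ]
  simp only [h, Finset.range_zero, Finset.inf_empty, inf_assoc]
  rw [← inf_iSup_eq]
  simp

theorem U_step (φ ψ : Formula) (t : T) :
    V.V (.U φ ψ) t = max (V.V ψ t) (min (V.V φ t) (V.V (.U φ ψ) (S t))) := by
  rw [V.U_eq, V.U_eq, iSup_until_unfold]
  simp only [perm_pow_succ_apply, pow_zero, Equiv.Perm.one_apply]

theorem S_step (φ ψ : Formula) (t : T) :
    V.V (.S φ ψ) (S t) = max (V.V ψ (S t)) (min (V.V φ (S t)) (V.V (.S φ ψ) t)) := by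
  rw [V.S_eq, V.S_eq, iSup_until_unfold]
  simp only [perm_inv_pow_succ_apply, pow_zero, Equiv.Perm.one_apply]

/-- The set of formulas of `Sg` that have a value of at least `r` at `t`. -/
def typeAt (Sg : Set Formula) (t : T) (r : Set.Ioi (0 : unitInterval)) : Set Formula :=
  {ψ ∈ Sg | r ≤ V.V ψ t}

theorem sensible_typeAt {Sg : Set Formula} (hsub : SubformulaClosed Sg) (t : T)
    (r : Set.Ioi (0 : unitInterval)) :
    Sensible Sg (V.typeAt Sg t r) (V.typeAt Sg (S t) r) where
  X_iff φ h := by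
    have h₁ : φ ∈ Sg := hsub _ h (by simp [Formula.children])
    simp [typeAt, h, h₁, V.X_eq]
  Y_iff φ h := by
    have h₁ : φ ∈ Sg := hsub _ h (by simp [Formula.children])
    simp [typeAt, h, h₁, V.Y_eq, ← Equiv.Perm.mul_apply S⁻¹]
  G_iff φ h := by
    have h₁ : φ ∈ Sg := hsub _ h (by simp [Formula.children])
    simp only [typeAt, Set.mem_sep_iff, h, h₁, true_and]
    rw [V.G_step, le_min_iff]
  H_iff φ h := by
    have h₁ : φ ∈ Sg := hsub _ h (by simp [Formula.children])
    simp only [typeAt, Set.mem_sep_iff, h, h₁, true_and]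
    rw [V.H_step, le_min_iff]
  U_iff φ ψ h := by
    have h₁ : φ ∈ Sg := hsub _ h (by simp [Formula.children])
    have h₂ : ψ ∈ Sg := hsub _ h (by simp [Formula.children])
    simp only [typeAt, Set.mem_sep_iff, h, h₁, h₂, true_and]
    rw [V.U_step, le_max_iff, le_min_iff]
  S_iff φ ψ h := by
    have h₁ : φ ∈ Sg := hsub _ h (by simp [Formula.children])
    have h₂ : ψ ∈ Sg := hsub _ h (by simp [Formula.children])
    simp only [typeAt, Set.mem_sep_iff, h, h₁, h₂, true_and]
    rw [V.S_step, le_max_iff, le_min_iff]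

theorem isType_typeAt {Sg : Set Formula} (hsub : SubformulaClosed Sg) (t : T)
    (r : Set.Ioi (0 : unitInterval)) : IsType Sg (V.typeAt Sg t r) where
  subset := Set.sep_subset _ _
  and_iff φ ψ h := by
    have h₁ : φ ∈ Sg := hsub _ h (by simp [Formula.children])
    have h₂ : ψ ∈ Sg := hsub _ h (by simp [Formula.children])
    simp [typeAt, h, h₁, h₂, V.and_eq]
  or_iff φ ψ h := by
    have h₁ : φ ∈ Sg := hsub _ h (by simp [Formula.children])
    have h₂ : ψ ∈ Sg := hsub _ h (by simp [Formula.children])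
    simp [typeAt, h, h₁, h₂, V.or_eq]
  imp_elim φ ψ h hm := by
    have h₂ : ψ ∈ Sg := hsub _ h (by simp [Formula.children])
    have := hm.2
    rw [V.imp_eq] at this
    by_cases hφ : φ ∈ V.typeAt Sg t r
    · refine .inr ⟨h₂, ?_⟩
      split_ifs at this with hle
      exacts [hφ.2.trans hle, this]
    · exact .inl hφ
  imp_intro φ ψ h hm := by
    refine ⟨h, ?_⟩
    rw [V.imp_eq]
    split_ifs
    exacts [unitInterval.le_one', hm.2]
  coimp_elim φ ψ h hm := by
    have h₁ : φ ∈ Sg := hsub _ h (by simp [Formula.children])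
    have := hm.2
    rw [V.coimp_eq] at this
    split_ifs at this
    exacts [absurd this (not_le.2 r.2), ⟨h₁, this⟩]
  coimp_intro φ ψ h hφ hψ := by
    have h₂ : ψ ∈ Sg := hsub _ h (by simp [Formula.children])
    refine ⟨h, ?_⟩
    rw [V.coimp_eq, if_neg fun hle => hψ ⟨h₂, hφ.2.trans hle⟩]
    exact hφ.2

/-- The flow of types along the orbit of `t`. -/
def typeFlow {Sg : Set Formula} (hsub : SubformulaClosed Sg) (t : T) :
    TypeFlow Sg (Set.Ioi (0 : unitInterval)) where
  ty k r := V.typeAt Sg ((S ^ k) t) r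
  anti _ _ _ h _ hψ := ⟨hψ.1, le_trans h hψ.2⟩
  isType _ _ := V.isType_typeAt hsub _ _
  imp_defect k r φ ψ h := by
    have h₁ : φ ∈ Sg := hsub _ h.1 (by simp [Formula.children])
    have h' : V.V (.imp φ ψ) ((S ^ k) t) < r := not_le.1 fun h' => h.2 ⟨h.1, h'⟩
    rw [V.imp_eq] at h'
    split_ifs at h' with hle
    · exact absurd unitInterval.le_one' h'.not_ge
    · rw [not_le] at hle
      -- The highest threshold not above `r` at which `φ` holds. It exceeds the value of `ψ`,
      -- because both `r` and the value of `φ` do.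
      refine ⟨⟨min r (V.V φ ((S ^ k) t)), lt_min r.2 (hle.trans_le' bot_le)⟩,
        Subtype.coe_le_coe.1 (min_le_left _ _),
        ⟨h₁, min_le_right _ _⟩, fun hψ => ?_⟩
      exact (lt_min h' hle).not_ge hψ.2
  coimp_defect k r φ ψ h := by
    have h₁ : φ ∈ Sg := hsub _ h.1 (by simp [Formula.children])
    have h' := h.2
    rw [V.coimp_eq] at h'
    split_ifs at h' with hle
    · exact absurd h' (not_le.2 r.2)
    · exact ⟨⟨V.V φ ((S ^ k) t), lt_of_lt_of_le r.2 h'⟩, h', ⟨h₁, le_rfl⟩, fun hψ => hle hψ.2⟩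
  sensible k w := by
    rw [perm_zpow_add_one_apply]
    exact V.sensible_typeAt hsub _ _

/-- Only finitely many values of formulas of `Sg` occur at `t`, so lowering the threshold slightly
crosses none of them. -/
theorem exists_lt_same_type {Sg : Set Formula} (hfin : Sg.Finite) (t : T)
    (r : Set.Ioi (0 : unitInterval)) : ∃ r' < r, V.typeAt Sg t r' = V.typeAt Sg t r := by
  obtain ⟨r', hlt, hpos, hr'⟩ := exists_lt_separating (hfin.image fun ψ => V.V ψ t) r.2
  refine ⟨⟨r', hpos⟩, hlt, Set.Subset.antisymm (fun ψ h => ⟨h.1, ?_⟩)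
    fun ψ h => ⟨h.1, hlt.le.trans h.2⟩⟩
  by_contra hlt'
  exact (hr' _ ⟨ψ, h.1, rfl⟩ (not_le.1 hlt')).not_ge h.2

theorem exists_of_lt_iSup_until {r : unitInterval} {f g : ℕ → unitInterval}
    (h : r < ⨆ n : ℕ, min ((Finset.range n).inf f) (g n)) :
    ∃ n, (∀ k < n, r ≤ f k) ∧ r ≤ g n := by
  obtain ⟨n, hn⟩ := lt_iSup_iff.1 h
  exact ⟨n, fun k hk => (lt_min_iff.1 hn).1.le.trans (Finset.inf_le (Finset.mem_range.2 hk)),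
    (lt_min_iff.1 hn).2.le⟩

/-- A supremum of value at least `r` need not be attained, so an until-formula may fail to be
realised along `r` itself. A slightly lower threshold of the same type lies strictly below the
supremum and is realised by one term. This is why `Realising` allows a change of point. For `G` and
`H`, an infimum below `r` already has a term below `r`. -/
theorem typeFlow_realising {Sg : Set Formula} (hsub : SubformulaClosed Sg) (hfin : Sg.Finite)
    (t : T) : (V.typeFlow hsub t).Realising where
  future o k r h := by
    cases o with
    | U α β =>
      have h₁ : α ∈ Sg := hsub _ h.1 (by simp [Formula.children])
      have h₂ : β ∈ Sg := hsub _ h.1 (by simp [Formula.children])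
      obtain ⟨r', hlt, heq⟩ := V.exists_lt_same_type hfin ((S ^ k) t) r
      have h' := lt_of_lt_of_le (Subtype.coe_lt_coe.2 hlt) h.2
      rw [V.U_eq] at h'
      obtain ⟨n, hα, hβ⟩ := exists_of_lt_iSup_until h'
      simp only [perm_pow_zpow_apply] at hα hβ
      exact ⟨r', heq, n, fun j hj => ⟨h₁, hα j hj⟩, h₂, hβ⟩
    | G β =>
      have h' : V.V (.G β) ((S ^ k) t) < r := not_le.1 fun h' => h.2 ⟨h.1, h'⟩
      rw [V.G_eq, iInf_lt_iff] at h'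
      simp only [perm_pow_zpow_apply] at h'
      obtain ⟨n, hn⟩ := h'
      exact ⟨r, rfl, n, fun _ _ => trivial, fun h' => hn.not_ge h'.2⟩
    | _ => exact h.elim
  past o k r h := by
    cases o with
    | S α β =>
      have h₁ : α ∈ Sg := hsub _ h.1 (by simp [Formula.children])
      have h₂ : β ∈ Sg := hsub _ h.1 (by simp [Formula.children])
      obtain ⟨r', hlt, heq⟩ := V.exists_lt_same_type hfin ((S ^ k) t) r
      have h' := lt_of_lt_of_le (Subtype.coe_lt_coe.2 hlt) h.2
      rw [V.S_eq] at h'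
      obtain ⟨n, hα, hβ⟩ := exists_of_lt_iSup_until h'
      simp only [perm_inv_pow_zpow_apply] at hα hβ
      exact ⟨r', heq, n, fun j hj => ⟨h₁, hα j hj⟩, h₂, hβ⟩
    | H β =>
      have h' : V.V (.H β) ((S ^ k) t) < r := not_le.1 fun h' => h.2 ⟨h.1, h'⟩
      rw [V.H_eq, iInf_lt_iff] at h'
      simp only [perm_inv_pow_zpow_apply] at h'
      obtain ⟨n, hn⟩ := h'
      exact ⟨r, rfl, n, fun _ _ => trivial, fun h' => hn.not_ge h'.2⟩
    | _ => exact h.elim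

end RealValuation

/-! ### From flows of types to small witnesses -/

theorem Moment.lab_subset_iff {Sg : Set Formula} (m : Moment Sg) {i j : Fin (m.top + 1)} :
    m.lab i ⊆ m.lab j ↔ j ≤ i :=
  StrictAnti.le_iff_ge (f := m.lab) fun i j h => m.strict i j h

theorem exists_strictAnti_range_eq {α : Type*} [PartialOrder α] {X : Set α} (hfin : X.Finite)
    (hne : X.Nonempty) (hX : IsChain (· ≤ ·) X) :
    ∃ (n : ℕ) (f : Fin (n + 1) → α), StrictAnti f ∧ Set.range f = X := by
  classical
  let _ : LinearOrder X := { (inferInstance : PartialOrder X) with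
    le_total := fun a b => hX.total a.2 b.2
    toDecidableLE := Classical.decRel _ }
  have : Fintype X := hfin.fintype
  have : Nonempty X := hne.to_subtype
  -- The order dual makes the enumeration decreasing, and nonemptiness gives the cardinality the
  -- form `n + 1`.
  have hcard : Fintype.card Xᵒᵈ = (Fintype.card X - 1) + 1 := by
    have : 0 < Fintype.card X := Fintype.card_pos
    rw [Fintype.card_orderDual]
    omega
  let e := Fintype.orderIsoFinOfCardEq Xᵒᵈ hcard
  refine ⟨_, fun i => (OrderDual.ofDual (e i) : X), fun i j h => ?_, ?_⟩
  · exact e.strictMono h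
  · ext x
    constructor
    · rintro ⟨i, rfl⟩
      exact (OrderDual.ofDual (e i)).2
    · intro hx
      exact ⟨e.symm (OrderDual.toDual ⟨x, hx⟩), by simp⟩

/-- For a finite set of conditions, each satisfied eventually, there is a common bound. -/
theorem exists_uniform_bound {α : Type*} {s : Set α} (hs : s.Finite) {P : α → ℕ → Prop}
    (h : ∀ x ∈ s, ∃ r, P x r) : ∃ N, ∀ x ∈ s, ∃ r < N, P x r := by
  choose! f hf using h
  obtain ⟨N, hN⟩ := (hs.image f).bddAbove
  exact ⟨N + 1, fun x hx => ⟨f x, Nat.lt_succ_of_le (hN ⟨x, hx, rfl⟩), hf x hx⟩⟩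

theorem exists_infinitely_often_eq {α : Type*} {s : Set α} (hs : s.Finite) {f : ℕ → α}
    (hf : ∀ n, f n ∈ s) : ∃ i, ∀ N, ∃ n ≥ N, f n = f i := by
  have := hs.to_subtype
  obtain ⟨⟨y, hy⟩, h⟩ := Finite.exists_infinite_fiber fun n => (⟨f n, hf n⟩ : s)
  have hinf := Set.infinite_coe_iff.1 h
  have key (N : ℕ) : ∃ n ≥ N, f n = y := by
    obtain ⟨n, hn, hlt⟩ := hinf.exists_gt N
    exact ⟨n, hlt.le, congrArg Subtype.val hn⟩
  obtain ⟨i, -, hi⟩ := key 0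
  exact ⟨i, fun N => by rw [hi]; exact key N⟩

namespace TypeFlow

variable {Sg : Set Formula} {W : Type*} [LinearOrder W] (F : TypeFlow Sg W)

theorem exists_moment [Nonempty W] (hfin : Sg.Finite) (k : ℤ) :
    ∃ m : Moment Sg, m.carrier = Set.range (F.ty k) := by
  have hf : (Set.range (F.ty k)).Finite :=
    hfin.finite_subsets.subset (by rintro _ ⟨w, rfl⟩; exact (F.isType k w).subset)
  have hc : IsChain (· ≤ ·) (Set.range (F.ty k)) := by
    rintro _ ⟨w, rfl⟩ _ ⟨v, rfl⟩ -
    exact (le_total v w).imp (fun h => F.anti k h) (fun h => F.anti k h)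
  obtain ⟨n, f, hanti, hrange⟩ := exists_strictAnti_range_eq hf (Set.range_nonempty _) hc
  have hmem (i) : ∃ w, F.ty k w = f i := by
    have : f i ∈ Set.range (F.ty k) := hrange ▸ ⟨i, rfl⟩
    exact this
  have hidx (w) : ∃ i, f i = F.ty k w := by
    have : F.ty k w ∈ Set.range f := hrange ▸ ⟨w, rfl⟩
    exact this
  refine ⟨⟨n, f, fun i => ?_, fun i j h => hanti h, fun i φ ψ h => ?_, fun i φ ψ h => ?_⟩, hrange⟩
  · obtain ⟨w, hw⟩ := hmem i
    exact hw ▸ F.isType k w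
  · obtain ⟨w, hw⟩ := hmem i
    obtain ⟨v, hv, h⟩ := F.imp_defect k w φ ψ (by rwa [hw])
    obtain ⟨j, hj⟩ := hidx v
    refine ⟨j, hanti.le_iff_ge.1 ?_, by rwa [hj]⟩
    rw [hj, ← hw]
    exact F.anti k hv
  · obtain ⟨w, hw⟩ := hmem i
    obtain ⟨v, hv, h⟩ := F.coimp_defect k w φ ψ (by rwa [hw])
    obtain ⟨j, hj⟩ := hidx v
    refine ⟨j, hanti.le_iff_ge.1 ?_, by rwa [hj]⟩
    rw [hj, ← hw]
    exact F.anti k hv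

open Classical in
/-- A moment with a given carrier, if there is one. -/
noncomputable def momentOf (m₀ : Moment Sg) (X : Set (Set Formula)) : Moment Sg :=
  if h : ∃ m : Moment Sg, m.carrier = X then h.choose else m₀

theorem carrier_momentOf [Nonempty W] (hfin : Sg.Finite) (m₀ : Moment Sg) (k : ℤ) :
    (momentOf m₀ (Set.range (F.ty k))).carrier = Set.range (F.ty k) := by
  rw [momentOf, dif_pos (F.exists_moment hfin k)]
  exact (F.exists_moment hfin k).choose_spec

/-- The relation between the types at `k` and the types at `k + 1` of the same points. -/
def rel (k : ℤ) (Φ Ψ : Set Formula) : Prop := ∃ w, F.ty k w = Φ ∧ F.ty (k + 1) w = Ψ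

/-- Each clause compares points of `W`. For confluence, take any point with the prescribed type:
either it lies on the right side of the given point and its other type is the answer, or the two
indices coincide and the given pair serves. For convexity, a point of the intermediate type lies
between the two given points, where its other type is squeezed, or else its index is that of an
endpoint. -/
theorem isTemporalStep_rel [Nonempty W] {k : ℤ} {m n : Moment Sg}
    (hm : m.carrier = Set.range (F.ty k)) (hn : n.carrier = Set.range (F.ty (k + 1))) :
    IsTemporalStep m n (F.rel k) := by
  have hidm (w) : ∃ i, m.lab i = F.ty k w := by
    have : F.ty k w ∈ m.carrier := hm ▸ ⟨w, rfl⟩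
    exact this
  have hidn (w) : ∃ i, n.lab i = F.ty (k + 1) w := by
    have : F.ty (k + 1) w ∈ n.carrier := hn ▸ ⟨w, rfl⟩
    exact this
  have hmem (i) : ∃ w, F.ty k w = m.lab i := by
    have : m.lab i ∈ Set.range (F.ty k) := hm ▸ ⟨i, rfl⟩
    exact this
  have hnem (i) : ∃ w, F.ty (k + 1) w = n.lab i := by
    have : n.lab i ∈ Set.range (F.ty (k + 1)) := hn ▸ ⟨i, rfl⟩
    exact this
  have le_m {i j v w} (hv : F.ty k v = m.lab i) (hw : F.ty k w = m.lab j) (h : v ≤ w) : i ≤ j := by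
    rw [← m.lab_subset_iff, ← hv, ← hw]; exact F.anti k h
  have le_n {i j v w} (hv : F.ty (k + 1) v = n.lab i) (hw : F.ty (k + 1) w = n.lab j)
      (h : v ≤ w) : i ≤ j := by
    rw [← n.lab_subset_iff, ← hv, ← hw]; exact F.anti _ h
  refine ⟨?_, ?_, ⟨?_, ?_, ?_, ?_⟩, ⟨?_, ?_⟩, ?_⟩
  · rintro _ _ ⟨w, rfl, rfl⟩
    exact ⟨hm ▸ ⟨w, rfl⟩, hn ▸ ⟨w, rfl⟩⟩
  · obtain ⟨w⟩ := ‹Nonempty W›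
    exact ⟨_, _, w, rfl, rfl⟩
  · rintro x x' y' hx ⟨w', h₁, h₂⟩
    obtain ⟨w, hw⟩ := hmem x
    obtain ⟨y, hy⟩ := hidn w
    rcases le_total w w' with h | h
    · exact ⟨y, ⟨w, hw, hy.symm⟩, le_n hy.symm h₂ h⟩
    · obtain rfl := le_antisymm hx (le_m h₁ hw h)
      exact ⟨y', ⟨w', h₁, h₂⟩, le_rfl⟩
  · rintro x x' y hx ⟨w, h₁, h₂⟩
    obtain ⟨w', hw⟩ := hmem x'
    obtain ⟨y', hy⟩ := hidn w'
    rcases le_total w w' with h | h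
    · exact ⟨y', ⟨w', hw, hy.symm⟩, le_n h₂ hy.symm h⟩
    · obtain rfl := le_antisymm hx (le_m hw h₁ h)
      exact ⟨y, ⟨w, h₁, h₂⟩, le_rfl⟩
  · rintro x' y y' ⟨w', h₁, h₂⟩ hy
    obtain ⟨w, hw⟩ := hnem y
    obtain ⟨x, hx⟩ := hidm w
    rcases le_total w w' with h | h
    · exact ⟨x, le_m hx.symm h₁ h, w, hx.symm, hw⟩
    · obtain rfl := le_antisymm hy (le_n h₂ hw h)
      exact ⟨x', le_rfl, w', h₁, h₂⟩
  · rintro x y y' ⟨w, h₁, h₂⟩ hy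
    obtain ⟨w', hw⟩ := hnem y'
    obtain ⟨x', hx⟩ := hidm w'
    rcases le_total w w' with h | h
    · exact ⟨x', le_m h₁ hx.symm h, w', hx.symm, hw⟩
    · obtain rfl := le_antisymm hy (le_n hw h₂ h)
      exact ⟨x, le_rfl, w, h₁, h₂⟩
  · rintro x
    refine ⟨?_⟩
    rintro y₁ ⟨w₁, h₁, h₁'⟩ y₂ ⟨w₂, h₂, h₂'⟩ y ⟨hy₁, hy₂⟩
    obtain ⟨w, hw⟩ := hnem y
    rcases le_total w w₁ with h | h
    · obtain rfl := le_antisymm hy₁ (le_n hw h₁' h)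
      exact ⟨w₁, h₁, h₁'⟩
    rcases le_total w₂ w with h' | h'
    · obtain rfl := le_antisymm hy₂ (le_n h₂' hw h')
      exact ⟨w₂, h₂, h₂'⟩
    exact ⟨w, Set.Subset.antisymm (h₁ ▸ F.anti k h) (h₂ ▸ F.anti k h'), hw⟩
  · rintro x
    refine ⟨?_⟩
    rintro y₁ ⟨w₁, h₁', h₁⟩ y₂ ⟨w₂, h₂', h₂⟩ y ⟨hy₁, hy₂⟩
    obtain ⟨w, hw⟩ := hmem y
    rcases le_total w w₁ with h | h
    · obtain rfl := le_antisymm hy₁ (le_m hw h₁' h)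
      exact ⟨w₁, h₁', h₁⟩
    rcases le_total w₂ w with h' | h'
    · obtain rfl := le_antisymm hy₂ (le_m h₂' hw h')
      exact ⟨w₂, h₂', h₂⟩
    exact ⟨w, hw, Set.Subset.antisymm (h₁ ▸ F.anti _ h) (h₂ ▸ F.anti _ h')⟩
  · rintro _ _ ⟨w, rfl, rfl⟩
    exact F.sensible k w

/-- `W` may be infinite, but only finitely many pairs of a type and an eventuality occur at time
`k`, and realisation depends on that pair alone. -/
theorem exists_future_bound (hfin : Sg.Finite) (hF : F.Realising) (k : ℤ) :
    ∃ N : ℕ, ∀ w o, FuturePending Sg o (F.ty k w) → ∃ r < N, ∃ v, F.ty k v = F.ty k w ∧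
      (∀ j < r, Holding o (F.ty (k + j) v)) ∧ Fulfilled o (F.ty (k + r) v) := by
  obtain ⟨N, hN⟩ := exists_uniform_bound
    (s := {x : Set Formula × Formula | x ∈ {X | X ⊆ Sg} ×ˢ Sg ∧ x.1 ∈ Set.range (F.ty k) ∧
      FuturePending Sg x.2 x.1})
    (P := fun x r => ∃ v, F.ty k v = x.1 ∧
      (∀ j < r, Holding x.2 (F.ty (k + j) v)) ∧ Fulfilled x.2 (F.ty (k + r) v))
    ((hfin.finite_subsets.prod hfin).subset (Set.sep_subset _ _)) (by
      rintro ⟨_, o⟩ ⟨-, ⟨w, rfl⟩, h⟩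
      obtain ⟨v, hv, r, h⟩ := hF.future o k w h
      exact ⟨r, v, hv, h⟩)
  refine ⟨N, fun w o h => ?_⟩
  have hsub := (F.isType k w).subset
  exact hN (F.ty k w, o) ⟨⟨hsub, h.mem hsub⟩, ⟨w, rfl⟩, h⟩

theorem exists_past_bound (hfin : Sg.Finite) (hF : F.Realising) (k : ℤ) :
    ∃ N : ℕ, ∀ w o, PastPending Sg o (F.ty k w) → ∃ r < N, ∃ v, F.ty k v = F.ty k w ∧
      (∀ j < r, Holding o (F.ty (k - j) v)) ∧ Fulfilled o (F.ty (k - r) v) := by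
  obtain ⟨N, hN⟩ := exists_uniform_bound
    (s := {x : Set Formula × Formula | x ∈ {X | X ⊆ Sg} ×ˢ Sg ∧ x.1 ∈ Set.range (F.ty k) ∧
      PastPending Sg x.2 x.1})
    (P := fun x r => ∃ v, F.ty k v = x.1 ∧
      (∀ j < r, Holding x.2 (F.ty (k - j) v)) ∧ Fulfilled x.2 (F.ty (k - r) v))
    ((hfin.finite_subsets.prod hfin).subset (Set.sep_subset _ _)) (by
      rintro ⟨_, o⟩ ⟨-, ⟨w, rfl⟩, h⟩
      obtain ⟨v, hv, r, h⟩ := hF.past o k w h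
      exact ⟨r, v, hv, h⟩)
  refine ⟨N, fun w o h => ?_⟩
  have hsub := (F.isType k w).subset
  exact hN (F.ty k w, o) ⟨⟨hsub, h.mem hsub⟩, ⟨w, rfl⟩, h⟩

theorem rel_succ (w : W) (k : ℤ) (j : ℕ) :
    F.rel (k + j) (F.ty (k + j) w) (F.ty (k + (j + 1 : ℕ)) w) :=
  ⟨w, rfl, by rw [Nat.cast_succ, add_assoc]⟩

theorem rel_pred (w : W) (k : ℤ) (j : ℕ) :
    F.rel (k - j - 1) (F.ty (k - (j + 1 : ℕ)) w) (F.ty (k - j) w) :=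
  ⟨w, by rw [Nat.cast_succ, sub_sub], by rw [sub_add_cancel]⟩

/-- A finite segment of a flow of types that falsifies `φ` is a small witness for `φ`. -/
theorem nonempty_smallWitness (hfin : Sg.Finite) (hF : F.Realising) {φ : Formula} {w₀ : W}
    (hw₀ : φ ∉ F.ty 0 w₀) : Nonempty (SmallWitness Sg φ) := by
  have : Nonempty W := ⟨w₀⟩
  obtain ⟨m₀, -⟩ := F.exists_moment hfin 0
  have hmem (k : ℤ) : Set.range (F.ty k) ∈ {X | X ⊆ {Φ | Φ ⊆ Sg}} := by
    rintro _ ⟨w, rfl⟩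
    exact (F.isType k w).subset
  -- The recurring time `i` comes first, since the bound `N` depends on it; a recurrence beyond `i +
  -- N` then makes the loop long enough.
  obtain ⟨i, hi⟩ := exists_infinitely_often_eq hfin.finite_subsets.finite_subsets
    fun n : ℕ => hmem n
  obtain ⟨i', hi'⟩ := exists_infinitely_often_eq hfin.finite_subsets.finite_subsets
    fun n : ℕ => hmem (-n)
  obtain ⟨N, hN⟩ := F.exists_future_bound hfin hF i
  obtain ⟨N', hN'⟩ := F.exists_past_bound hfin hF (-i')
  obtain ⟨n, hn, hrep⟩ := hi (i + N + 1)
  obtain ⟨n', hn', hrep'⟩ := hi' (i' + N' + 1)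
  obtain ⟨l, rfl⟩ := Nat.exists_eq_add_of_le (show i ≤ n by omega)
  obtain ⟨l', rfl⟩ := Nat.exists_eq_add_of_le (show i' ≤ n' by omega)
  have hc := F.carrier_momentOf hfin m₀
  have hfut : ∀ Φ ∈ (momentOf m₀ (Set.range (F.ty i))).carrier, ∀ o, FuturePending Sg o Φ →
      ∃ r < l, ∃ v, F.ty i v = Φ ∧
        (∀ j < r, Holding o (F.ty (i + j) v)) ∧ Fulfilled o (F.ty (i + r) v) := by
    intro Φ hΦ o ho
    rw [hc] at hΦ
    obtain ⟨w, rfl⟩ := hΦ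
    obtain ⟨r, hr, h⟩ := hN w o ho
    exact ⟨r, by omega, h⟩
  have hpast : ∀ Φ ∈ (momentOf m₀ (Set.range (F.ty (-i')))).carrier, ∀ o, PastPending Sg o Φ →
      ∃ r < l', ∃ v, F.ty (-i') v = Φ ∧
        (∀ j < r, Holding o (F.ty (-i' - j) v)) ∧ Fulfilled o (F.ty (-i' - r) v) := by
    intro Φ hΦ o ho
    rw [hc] at hΦ
    obtain ⟨w, rfl⟩ := hΦ
    obtain ⟨r, hr, h⟩ := hN' w o ho
    exact ⟨r, by omega, h⟩
  refine ⟨{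
    i' := i'
    i := i
    l' := l'
    l := l
    l'_pos := by omega
    l_pos := by omega
    -- The moment is chosen from the set of types alone, so times with the same set receive equal
    -- moments, as the loop conditions demand.
    mom := fun k => momentOf m₀ (Set.range (F.ty k))
    rel := fun k => F.rel k
    falsifies := ⟨F.ty 0 w₀, by rw [hc]; exact ⟨w₀, rfl⟩, hw₀⟩
    past_loop := ?_
    future_loop := ?_
    step := fun k _ _ => F.isTemporalStep_rel (hc k) (hc (k + 1))
    until_realised := fun Φ hΦ α β h => ?_
    G_realised := fun Φ hΦ β h => ?_
    since_realised := fun Φ hΦ α β h => ?_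
    H_realised := fun Φ hΦ β h => ?_ }⟩
  · have : -(i' : ℤ) - l' = -((i' + l' : ℕ) : ℤ) := by push_cast; ring
    simp only [this, hrep']
  · simp only [← Nat.cast_add, hrep]
  · obtain ⟨r, hr, v, hv, h₁, h₂⟩ := hfut Φ hΦ (.U α β) h
    exact ⟨r, hr, fun j => F.ty (i + j) v, by simpa using hv,
      fun k hk => ⟨F.rel_succ v i k, h₁ k hk⟩, h₂⟩
  · obtain ⟨r, hr, v, hv, h₁, h₂⟩ := hfut Φ hΦ (.G β) h
    exact ⟨r, hr, fun j => F.ty (i + j) v, by simpa using hv,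
      fun k hk => F.rel_succ v i k, h₂⟩
  · obtain ⟨r, hr, v, hv, h₁, h₂⟩ := hpast Φ hΦ (.S α β) h
    exact ⟨r, hr, fun j => F.ty (-i' - j) v, by simpa using hv,
      fun k hk => ⟨F.rel_pred v (-i') k, h₁ k hk⟩, h₂⟩
  · obtain ⟨r, hr, v, hv, h₁, h₂⟩ := hpast Φ hΦ (.H β) h
    exact ⟨r, hr, fun j => F.ty (-i' - j) v, by simpa using hv,
      fun k hk => F.rel_pred v (-i') k, h₂⟩

end TypeFlow

/-! ### Threads -/

/-- A bi-infinite sequence of sets of natural numbers, with relations between consecutive ones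
that are total, surjective, and closed under uncrossing. -/
structure ThreadSystem where
  D : ℤ → Set ℕ
  R : ℤ → ℕ → ℕ → Prop
  mem_left : ∀ {k x y}, R k x y → x ∈ D k
  mem_right : ∀ {k x y}, R k x y → y ∈ D (k + 1)
  serial : ∀ k, ∀ x ∈ D k, ∃ y, R k x y
  coserial : ∀ k, ∀ y ∈ D (k + 1), ∃ x, R k x y
  uncross : ∀ {k x x' y y'}, R k x y → R k x' y' → x ≤ x' → y' ≤ y → R k x y' ∧ R k x' y

namespace ThreadSystem

variable (A : ThreadSystem)

/-- The thread system read in the opposite direction. -/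
def reverse : ThreadSystem where
  D k := A.D (-k)
  R k x y := A.R (-k - 1) y x
  mem_left h := by simpa using A.mem_right h
  mem_right h := by rw [neg_add']; exact A.mem_left h
  serial k x hx := A.coserial (-k - 1) x (by simpa using hx)
  coserial k y hy := A.serial (-k - 1) y (by rwa [neg_add'] at hy)
  uncross h₁ h₂ hx hy := A.uncross h₂ h₁ hy hx

/-- A bi-infinite path through a thread system. -/
def IsThread (p : ℤ → ℕ) : Prop := ∀ k, A.R k (p k) (p (k + 1))

variable {A}

theorem IsThread.mem {p : ℤ → ℕ} (hp : A.IsThread p) (k : ℤ) : p k ∈ A.D k := A.mem_left (hp k)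

theorem IsThread.reverse {p : ℤ → ℕ} (hp : A.IsThread p) :
    A.reverse.IsThread fun k => p (-k) := by
  intro k
  have := hp (-k - 1)
  rw [sub_add_cancel] at this
  simpa only [ThreadSystem.reverse, neg_add'] using this

theorem IsThread.of_reverse {p : ℤ → ℕ} (hp : A.reverse.IsThread p) :
    A.IsThread fun k => p (-k) := by
  intro k
  have := hp (-k - 1)
  simp only [ThreadSystem.reverse, neg_sub, sub_neg_eq_add, sub_add_cancel] at this
  rwa [add_sub_cancel_left, ← neg_add'] at this

/-- Only a step at which `p` and `q` change order needs an argument, and there `uncross` supplies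
the pair of minima. -/
theorem IsThread.inf {p q : ℤ → ℕ} (hp : A.IsThread p) (hq : A.IsThread q) :
    A.IsThread fun k => min (p k) (q k) := by
  intro k
  simp only
  rcases le_total (p k) (q k) with h | h <;> rcases le_total (p (k + 1)) (q (k + 1)) with h' | h'
  · rw [min_eq_left h, min_eq_left h']; exact hp k
  · rw [min_eq_left h, min_eq_right h']; exact (A.uncross (hp k) (hq k) h h').1
  · rw [min_eq_right h, min_eq_left h']; exact (A.uncross (hq k) (hp k) h h').1
  · rw [min_eq_right h, min_eq_right h']; exact hq k

theorem IsThread.sup {p q : ℤ → ℕ} (hp : A.IsThread p) (hq : A.IsThread q) :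
    A.IsThread fun k => max (p k) (q k) := by
  intro k
  simp only
  rcases le_total (p k) (q k) with h | h <;> rcases le_total (p (k + 1)) (q (k + 1)) with h' | h'
  · rw [max_eq_right h, max_eq_right h']; exact hq k
  · rw [max_eq_right h, max_eq_left h']; exact (A.uncross (hp k) (hq k) h h').2
  · rw [max_eq_left h, max_eq_right h']; exact (A.uncross (hq k) (hp k) h h').2
  · rw [max_eq_left h, max_eq_left h']; exact hp k

/-- The sequence that follows `p` up to time `N` and `q` afterwards. -/
def glue (N : ℤ) (p q : ℤ → ℕ) (k : ℤ) : ℕ := if k ≤ N then p k else q k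

theorem glue_of_le {N : ℤ} {p q : ℤ → ℕ} {k : ℤ} (h : k ≤ N) : glue N p q k = p k := if_pos h

theorem glue_of_gt {N : ℤ} {p q : ℤ → ℕ} {k : ℤ} (h : N < k) : glue N p q k = q k :=
  if_neg h.not_ge

theorem glue_of_ge {N : ℤ} {p q : ℤ → ℕ} (hN : p N = q N) {k : ℤ} (h : N ≤ k) :
    glue N p q k = q k := by
  rcases h.eq_or_lt with rfl | h
  exacts [(glue_of_le le_rfl).trans hN, glue_of_gt h]

theorem IsThread.glue_of_rel {p q : ℤ → ℕ} (hp : A.IsThread p) (hq : A.IsThread q) {N : ℤ}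
    (hN : A.R N (p N) (q (N + 1))) : A.IsThread (glue N p q) := by
  intro k
  rcases lt_trichotomy k N with h | rfl | h
  · rw [glue_of_le h.le, glue_of_le (by omega)]; exact hp k
  · rwa [glue_of_le le_rfl, glue_of_gt (by omega)]
  · rw [glue_of_gt h, glue_of_gt (by omega)]; exact hq k

theorem IsThread.glue {p q : ℤ → ℕ} (hp : A.IsThread p) (hq : A.IsThread q) {N : ℤ}
    (hN : p N = q N) : A.IsThread (glue N p q) :=
  hp.glue_of_rel hq (hN ▸ hq N)

theorem exists_forward_path {k : ℤ} {x : ℕ} (hx : x ∈ A.D k) :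
    ∃ f : ℤ → ℕ, f k = x ∧ ∀ j ≥ k, A.R j (f j) (f (j + 1)) := by
  choose! s hs using A.serial
  let g : ℕ → ℕ := fun n => Nat.rec x (fun n y => s (k + n) y) n
  have hg (n : ℕ) : g n ∈ A.D (k + n) := by
    induction n with
    | zero => simpa [g] using hx
    | succ n ih => simpa [add_assoc] using A.mem_right (hs _ _ ih)
  refine ⟨fun j => g (j - k).toNat, by simp [g], fun j hj => ?_⟩
  obtain ⟨n, rfl⟩ := Int.le.dest hj
  have h₁ : (k + n - k).toNat = n := by omega
  have h₂ : (k + n + 1 - k).toNat = n + 1 := by omega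
  simp only [h₁, h₂]
  exact hs _ _ (hg n)

theorem exists_thread {k : ℤ} {x : ℕ} (hx : x ∈ A.D k) : ∃ p, A.IsThread p ∧ p k = x := by
  obtain ⟨f, hfk, hf⟩ := exists_forward_path hx
  obtain ⟨g, hgk, hg⟩ := exists_forward_path (A := A.reverse) (k := -k) (x := x)
    (by simpa [reverse] using hx)
  refine ⟨ThreadSystem.glue k (fun j => g (-j)) f, fun j => ?_, by rw [glue_of_le le_rfl, hgk]⟩
  rcases lt_or_ge j k with h | h
  · rw [glue_of_le h.le, glue_of_le (by omega)]
    have := hg (-j - 1) (by omega)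
    simp only [ThreadSystem.reverse, neg_sub, sub_neg_eq_add, sub_add_cancel] at this
    rwa [add_sub_cancel_left, ← neg_add'] at this
  · rw [glue_of_ge (by rw [hgk, hfk]) h, glue_of_gt (by omega)]
    exact hf j h

theorem exists_thread_extending {k : ℤ} (x : ℕ → ℕ) (hx : x 0 ∈ A.D k) (r : ℕ)
    (h : ∀ j < r, A.R (k + j) (x j) (x (j + 1))) :
    ∃ p, A.IsThread p ∧ ∀ j ≤ r, p (k + j) = x j := by
  induction r with
  | zero =>
    obtain ⟨p, hp, hpk⟩ := exists_thread hx
    exact ⟨p, hp, by simpa using hpk⟩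
  | succ r ih =>
    obtain ⟨p, hp, hpx⟩ := ih fun j hj => h j (by omega)
    have hr := h r (by omega)
    obtain ⟨q, hq, hqx⟩ := exists_thread (A.mem_right hr)
    refine ⟨_, hp.glue_of_rel hq (N := k + r) ?_, fun j hj => ?_⟩
    · rwa [hpx r le_rfl, hqx]
    · rcases hj.eq_or_lt with rfl | hj
      · rw [glue_of_gt (by omega), Nat.cast_succ, ← add_assoc, hqx]
      · rw [glue_of_le (by omega), hpx j (by omega)]

/-! ### Fulfilling threads -/

/-- Eventualities, indexed by `ι`, for a thread system: when pending, an eventuality is either done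
at once or remains pending in the next step. -/
structure Eventualities (A : ThreadSystem) (ι : Type*) where
  pend : ι → ℤ → ℕ → Prop
  done : ι → ℤ → ℕ → Prop
  persist : ∀ {o k x y}, A.R k x y → pend o k x → done o k x ∨ pend o (k + 1) y

/-- Every eventuality pending on `p` is done later on `p`. -/
def Eventualities.Fulfils {ι : Type*} (E : Eventualities A ι) (p : ℤ → ℕ) : Prop :=
  ∀ o k, E.pend o k (p k) → ∃ n ≥ k, E.done o n (p n)

variable {ι ι' : Type*} {E : Eventualities A ι}

theorem IsThread.done_or_pend {p : ℤ → ℕ} (hp : A.IsThread p) {o : ι} {k N : ℤ} (hkN : k ≤ N)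
    (h : E.pend o k (p k)) : (∃ n ≥ k, n < N ∧ E.done o n (p n)) ∨ E.pend o N (p N) := by
  induction N, hkN using Int.leInduction with
  | base => exact .inr h
  | succ N hN ih =>
    rcases ih with ⟨n, h₁, h₂, h₃⟩ | ih
    · exact .inl ⟨n, h₁, by omega, h₃⟩
    · exact (E.persist (hp N) ih).imp (fun h => ⟨N, hN, by omega, h⟩) id

/-- Fulfilment is a property of the tail: a debt from before `N` is paid by then or is still owed at
`N`. Hence the future and the past of a thread can be repaired separately. -/
theorem IsThread.fulfils_of_eq {p q : ℤ → ℕ} (hp : A.IsThread p) (hq : E.Fulfils q) (N : ℤ)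
    (h : ∀ k ≥ N, p k = q k) : E.Fulfils p := by
  intro o k hk
  rcases hp.done_or_pend (le_max_left k N) hk with ⟨n, h₁, -, h₂⟩ | h'
  · exact ⟨n, h₁, h₂⟩
  · rw [h _ (le_max_right k N)] at h'
    obtain ⟨n, hn, h'⟩ := hq o _ h'
    refine ⟨n, (le_max_left k N).trans hn, ?_⟩
    rwa [h n ((le_max_right k N).trans hn)]

/-- If `p₀` meets `a` at some time from `t` on, switch to `a` there for good. If it never does, `p₀`
coincides with `p` from `t` on. Either way the tail is that of a fulfilling thread. -/
theorem exists_fulfilling_of_mixture {p₀ p a : ℤ → ℕ} (hp₀ : A.IsThread p₀)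
    (h : ∀ k, p₀ k = p k ∨ p₀ k = a k) (ha : A.IsThread a) (hpE : E.Fulfils p) (haE : E.Fulfils a)
    (t : ℤ) : ∃ q, A.IsThread q ∧ (∀ k ≤ t, q k = p₀ k) ∧ (∀ k, q k = p₀ k ∨ q k = a k) ∧
      E.Fulfils q := by
  by_cases hN : ∃ N ≥ t, p₀ N = a N
  · obtain ⟨N, hN, heq⟩ := hN
    refine ⟨_, hp₀.glue ha heq, fun k hk => glue_of_le (by omega), fun k => ?_,
      (hp₀.glue ha heq).fulfils_of_eq haE N fun k hk => glue_of_ge heq hk⟩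
    rcases le_or_gt k N with hk | hk
    exacts [.inl (glue_of_le hk), .inr (glue_of_gt hk)]
  · push Not at hN
    exact ⟨p₀, hp₀, fun _ _ => rfl, fun _ => .inl rfl,
      hp₀.fulfils_of_eq hpE t fun k hk => (h k).resolve_right (hN k hk)⟩

/-- If each pending eventuality can be done on some thread, then some single thread through a given
point fulfils all eventualities. -/
theorem exists_fulfilling_thread [Countable ι]
    (hE : ∀ o k x, x ∈ A.D k → E.pend o k x →
      ∃ p, A.IsThread p ∧ p k = x ∧ ∃ n ≥ k, E.done o n (p n))
    {k₀ : ℤ} {x₀ : ℕ} (hx₀ : x₀ ∈ A.D k₀) : ∃ p, A.IsThread p ∧ p k₀ = x₀ ∧ E.Fulfils p := by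
  obtain ⟨p₀, hp₀, hpk₀⟩ := exists_thread hx₀
  rcases isEmpty_or_nonempty ι with hι | hι
  · exact ⟨p₀, hp₀, hpk₀, fun o => hι.elim o⟩
  have hstep (o : ι) (s : {p // A.IsThread p} × ℤ) : ∃ s' : {p // A.IsThread p} × ℤ, s.2 < s'.2 ∧
      (∀ k ≤ s.2, s'.1.1 k = s.1.1 k) ∧
      (E.pend o s.2 (s.1.1 s.2) → ∃ n ≥ s.2, n ≤ s'.2 ∧ E.done o n (s'.1.1 n)) := by
    obtain ⟨⟨p, hp⟩, N⟩ := s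
    by_cases hpend : E.pend o N (p N)
    · obtain ⟨q, hq, hqN, n, hn, hdone⟩ := hE o N _ (hp.mem N) hpend
      refine ⟨⟨⟨_, hp.glue hq hqN.symm⟩, n + 1⟩, by simp only; omega,
        fun k hk => glue_of_le hk, fun _ => ⟨n, hn, by simp, ?_⟩⟩
      simpa only [glue_of_ge hqN.symm hn] using hdone
    · exact ⟨⟨⟨p, hp⟩, N + 1⟩, by simp, fun _ _ => rfl, fun h => absurd h hpend⟩
  choose next hlt heq hdone using hstep
  obtain ⟨e, he⟩ := exists_surjective_nat ι
  let s : ℕ → {p // A.IsThread p} × ℤ := fun n =>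
    Nat.rec (⟨p₀, hp₀⟩, k₀) (fun n s => next (e n.unpair.1) s) n
  have hN (n : ℕ) : k₀ + n ≤ (s n).2 := by
    induction n with
    | zero => simp [s]
    | succ n ih => have := hlt (e n.unpair.1) (s n); simp only [s] at *; push_cast; omega
  have hmono : Monotone fun n => (s n).2 := monotone_nat_of_le_succ fun n => (hlt _ (s n)).le
  have hagree {n m : ℕ} (hnm : n ≤ m) {k : ℤ} (hk : k ≤ (s n).2) :
      (s m).1.1 k = (s n).1.1 k := by
    induction m, hnm using Nat.le_induction with
    | base => rfl
    | succ m hm ih => rw [← ih]; exact heq _ (s m) k (hk.trans (hmono hm))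
  -- Stage `n` is final up to the time `(s n).2 ≥ k₀ + n`, so the limit may be read off at any
  -- sufficiently late stage.
  let q : ℤ → ℕ := fun k => (s (k - k₀).toNat).1.1 k
  have hq (n : ℕ) {k : ℤ} (hk : k ≤ (s n).2) : q k = (s n).1.1 k := by
    have hk' : k ≤ (s (k - k₀).toNat).2 := by
      have := hN (k - k₀).toNat
      omega
    rcases le_total n (k - k₀).toNat with h | h
    exacts [hagree h hk, (hagree h hk').symm]
  have hqT : A.IsThread q := by
    intro k
    have := hN (k + 1 - k₀).toNat
    rw [hq (k + 1 - k₀).toNat (k := k) (by omega), hq (k + 1 - k₀).toNat (k := k + 1) (by omega)]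
    exact (s _).1.2 k
  refine ⟨q, hqT, ?_, fun o k hk => ?_⟩
  · rw [hq 0 (by simp [s])]
    exact hpk₀
  · obtain ⟨c, rfl⟩ := he o
    -- Pairing schedules every eventuality infinitely often. This stage treats `e c` at a time no
    -- earlier than `k`, when the debt is either paid or still pending.
    let m := Nat.pair c (k - k₀).toNat
    have hm : k ≤ (s m).2 := by
      have h₁ := hN m
      have h₂ : (k - k₀).toNat ≤ m := Nat.right_le_pair _ _
      omega
    rcases hqT.done_or_pend hm hk with ⟨n, h₁, -, h₂⟩ | h
    · exact ⟨n, h₁, h₂⟩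
    · rw [hq m le_rfl] at h
      have hem : e (m.unpair.1) = e c := by simp [m]
      obtain ⟨n, h₁, h₂, h₃⟩ := hdone (e m.unpair.1) (s m) (by rwa [hem])
      rw [hem] at h₃
      refine ⟨n, hm.trans h₁, ?_⟩
      rw [hq (m + 1) h₂]
      simpa [s, hem] using h₃

/-! ### Chains of threads that fulfil all eventualities -/

/-- A thread that fulfils all eventualities in both directions. -/
structure IsGood (E : Eventualities A ι) (E' : Eventualities A.reverse ι') (p : ℤ → ℕ) :
    Prop where
  isThread : A.IsThread p
  future : E.Fulfils p
  past : E'.Fulfils fun k => p (-k)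

variable {E' : Eventualities A.reverse ι'}

/-- The past is repaired before `t`, then the future after `t`. The first repair introduces only
values of `a`, so the result is still a mixture of `p` and `a`, and the second leaves the past tail
untouched. -/
theorem IsGood.of_mixture {p₀ p a : ℤ → ℕ} (hp₀ : A.IsThread p₀)
    (h : ∀ k, p₀ k = p k ∨ p₀ k = a k) (hp : IsGood E E' p) (ha : IsGood E E' a)
    (t : ℤ) : ∃ q, IsGood E E' q ∧ q t = p₀ t ∧ ∀ k, q k = p₀ k ∨ q k = a k := by
  obtain ⟨q₁, hq₁, h₁, h₂, h₃⟩ := exists_fulfilling_of_mixture hp₀.reverse (fun k => h (-k))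
    ha.isThread.reverse hp.past ha.past (-t)
  have hq₁a (k : ℤ) : q₁ (-k) = p₀ k ∨ q₁ (-k) = a k := by simpa using h₂ (-k)
  have hmix (k : ℤ) : q₁ (-k) = p k ∨ q₁ (-k) = a k := by
    rcases hq₁a k with h' | h'
    · rw [h']; exact h k
    · exact .inr h'
  obtain ⟨q, hq, h₄, h₅, h₆⟩ := exists_fulfilling_of_mixture hq₁.of_reverse hmix ha.isThread
    hp.future ha.future t
  refine ⟨q, ⟨hq, h₆, hq.reverse.fulfils_of_eq h₃ (-t) fun k hk => ?_⟩, ?_, fun k => ?_⟩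
  · simpa using h₄ (-k) (by omega)
  · rw [h₄ t le_rfl, h₁ _ le_rfl, neg_neg]
  · rcases h₅ k with h' | h'
    · rw [h']; exact hq₁a k
    · exact .inr h'

theorem IsGood.exists_le {p a : ℤ → ℕ} (hp : IsGood E E' p) (ha : IsGood E E' a) {t : ℤ}
    (ht : p t ≤ a t) : ∃ q, IsGood E E' q ∧ q t = p t ∧
      ∀ k, q k = min (p k) (a k) ∨ q k = a k := by
  obtain ⟨q, hq, hqt, h⟩ := IsGood.of_mixture (hp.isThread.inf ha.isThread)
    (fun k => min_choice _ _) hp ha t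
  exact ⟨q, hq, by rw [hqt, min_eq_left ht], h⟩

/-- The pointwise alternative says more than `b ≤ q`: any common upper bound of `p` and `b` also
bounds `q`, so bounds from above survive this move. -/
theorem IsGood.exists_ge {p b : ℤ → ℕ} (hp : IsGood E E' p) (hb : IsGood E E' b) {t : ℤ}
    (ht : b t ≤ p t) : ∃ q, IsGood E E' q ∧ q t = p t ∧
      ∀ k, q k = max (p k) (b k) ∨ q k = b k := by
  obtain ⟨q, hq, hqt, h⟩ := IsGood.of_mixture (hp.isThread.sup hb.isThread)
    (fun k => max_choice _ _) hp hb t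
  exact ⟨q, hq, by rw [hqt, max_eq_left ht], h⟩

/-- A finite chain of good threads can be extended by a good thread through a given point that lies
on some good thread. -/
theorem IsGood.exists_insert {C : Set (ℤ → ℕ)} (hfin : C.Finite) (hC : IsChain (· ≤ ·) C)
    (hgood : ∀ p ∈ C, IsGood E E' p) {p : ℤ → ℕ} (hp : IsGood E E' p) (t : ℤ) :
    ∃ q, IsGood E E' q ∧ q t = p t ∧ IsChain (· ≤ ·) (insert q C) := by
  by_cases hex : ∃ f ∈ C, f t = p t
  · obtain ⟨f, hf, hft⟩ := hex
    exact ⟨f, hgood f hf, hft, by rwa [Set.insert_eq_of_mem hf]⟩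
  push Not at hex
  have h₁ : ∃ q, IsGood E E' q ∧ q t = p t ∧ ∀ f ∈ C, p t < f t → q ≤ f := by
    rcases Set.eq_empty_or_nonempty {f ∈ C | p t < f t} with h | h
    · refine ⟨p, hp, rfl, fun f hf hlt => absurd ⟨hf, hlt⟩ (Set.eq_empty_iff_forall_notMem.1 h f)⟩
    -- In a chain this minimal member lies below all the others that pass above the point, so it
    -- suffices to get below `a`.
    · obtain ⟨a, ⟨haC, ha⟩, hmin⟩ := (hfin.subset (Set.sep_subset C _)).exists_minimal h
      obtain ⟨q, hq, hqt, hqa⟩ := hp.exists_le (hgood a haC) ha.le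
      refine ⟨q, hq, hqt, fun f hf hlt => le_trans (b := a) (fun k => ?_) ?_⟩
      · rcases hqa k with h' | h' <;> rw [h']
        exact min_le_right _ _
      · rcases hC.total haC hf with h' | h'
        exacts [h', hmin ⟨hf, hlt⟩ h']
  obtain ⟨p₁, hp₁, hp₁t, hle⟩ := h₁
  have h₂ : ∃ q, IsGood E E' q ∧ q t = p t ∧ (∀ f ∈ C, p t < f t → q ≤ f) ∧
      ∀ f ∈ C, f t < p t → f ≤ q := by
    rcases Set.eq_empty_or_nonempty {f ∈ C | f t < p t} with h | h
    · refine ⟨p₁, hp₁, hp₁t, hle,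
        fun f hf hlt => absurd ⟨hf, hlt⟩ (Set.eq_empty_iff_forall_notMem.1 h f)⟩
    · obtain ⟨b, ⟨hbC, hb⟩, hmax⟩ := (hfin.subset (Set.sep_subset C _)).exists_maximal h
      obtain ⟨q, hq, hqt, hqb⟩ := hp₁.exists_ge (hgood b hbC) (hp₁t ▸ hb.le)
      refine ⟨q, hq, hqt.trans hp₁t, fun f hf hlt k => ?_,
        fun f hf hlt => le_trans (b := b) ?_ fun k => ?_⟩
      -- At time `t` the new point lies strictly between `b` and `f`, which settles the order of
      -- these two threads at all times.
      · have hbf : b ≤ f := (hC.total hbC hf).resolve_right fun h' =>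
          absurd (h' t) (not_le.2 (hb.trans hlt))
        rcases hqb k with h' | h' <;> rw [h']
        exacts [max_le (hle f hf hlt k) (hbf k), hbf k]
      · rcases hC.total hf hbC with h' | h'
        exacts [h', hmax ⟨hf, hlt⟩ h']
      · rcases hqb k with h' | h' <;> rw [h']
        exact le_max_right _ _
  obtain ⟨q, hq, hqt, hup, hdown⟩ := h₂
  refine ⟨q, hq, hqt, hC.insert fun f hf _ => ?_⟩
  rcases lt_or_gt_of_ne (hex f hf) with h | h
  exacts [.inr (hdown f hf h), .inl (hup f hf h)]

/-- If every point lies on a good thread, there is a countable chain of good threads that covers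
all points. -/
theorem exists_countable_chain (h : ∀ k, ∀ x ∈ A.D k, ∃ p, IsGood E E' p ∧ p k = x) :
    ∃ C : Set (ℤ → ℕ), C.Countable ∧ IsChain (· ≤ ·) C ∧ (∀ p ∈ C, IsGood E E' p) ∧
      ∀ k, ∀ x ∈ A.D k, ∃ p ∈ C, p k = x := by
  let GoodChain := {C : Set (ℤ → ℕ) // C.Finite ∧ IsChain (· ≤ ·) C ∧ ∀ p ∈ C, IsGood E E' p}
  have hstep (r : ℤ × ℕ) (C : GoodChain) : ∃ C' : GoodChain, C.1 ⊆ C'.1 ∧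
      (r.2 ∈ A.D r.1 → ∃ p ∈ C'.1, p r.1 = r.2) := by
    by_cases hr : r.2 ∈ A.D r.1
    · obtain ⟨p, hp, hpr⟩ := h r.1 r.2 hr
      obtain ⟨q, hq, hqt, hchain⟩ := IsGood.exists_insert C.2.1 C.2.2.1 C.2.2.2 hp r.1
      refine ⟨⟨insert q C.1, C.2.1.insert q, hchain, ?_⟩, Set.subset_insert _ _,
        fun _ => ⟨q, Set.mem_insert _ _, hqt.trans hpr⟩⟩
      rintro f (rfl | hf)
      exacts [hq, C.2.2.2 f hf]
    · exact ⟨C, subset_rfl, fun h => absurd h hr⟩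
  choose next hsub hnext using hstep
  obtain ⟨e, he⟩ := exists_surjective_nat (ℤ × ℕ)
  let s : ℕ → GoodChain := fun n =>
    Nat.rec ⟨∅, Set.finite_empty, IsChain.empty, by simp⟩ (fun n C => next (e n) C) n
  have hmono : Monotone fun n => (s n).1 := monotone_nat_of_le_succ fun n => hsub _ (s n)
  refine ⟨⋃ n, (s n).1, Set.countable_iUnion fun n => (s n).2.1.countable, ?_, ?_, ?_⟩
  · intro p hp q hq hne
    obtain ⟨n, hn⟩ := Set.mem_iUnion.1 hp
    obtain ⟨m, hm⟩ := Set.mem_iUnion.1 hq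
    exact (s (max n m)).2.2.1 (hmono (le_max_left n m) hn) (hmono (le_max_right n m) hm) hne
  · intro p hp
    obtain ⟨n, hn⟩ := Set.mem_iUnion.1 hp
    exact (s n).2.2.2 p hn
  · intro k x hx
    obtain ⟨n, hn⟩ := he (k, x)
    obtain ⟨p, hp, hpx⟩ := hnext (e n) (s n) (by rwa [hn])
    rw [hn] at hpx
    exact ⟨p, Set.mem_iUnion.2 ⟨n + 1, hp⟩, hpx⟩

end ThreadSystem

/-! ### Unrolled witnesses -/

/-- A bi-infinite sequence of moments and temporal steps in which eventualities are realised
arbitrarily late and arbitrarily early. -/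
structure UnrolledWitness (Sg : Set Formula) where
  mom : ℤ → Moment Sg
  rel : ℤ → Set Formula → Set Formula → Prop
  step : ∀ k, IsTemporalStep (mom k) (mom (k + 1)) (rel k)
  future : ∀ K₀, ∃ K ≥ K₀, ∀ Φ ∈ (mom K).carrier, ∀ o, FuturePending Sg o Φ →
    ∃ (r : ℕ) (P : ℕ → Set Formula), P 0 = Φ ∧
      (∀ k < r, rel (K + k) (P k) (P (k + 1))) ∧ Fulfilled o (P r)
  past : ∀ K₀, ∃ K ≤ K₀, ∀ Φ ∈ (mom K).carrier, ∀ o, PastPending Sg o Φ →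
    ∃ (r : ℕ) (P : ℕ → Set Formula), P 0 = Φ ∧
      (∀ k < r, rel (K - k - 1) (P (k + 1)) (P k)) ∧ Fulfilled o (P r)

namespace SmallWitness

variable {Sg : Set Formula} {φ : Formula} (w : SmallWitness Sg φ)

/-- The position in a small witness of the step that is used at time `k` in its unrolling. -/
def fold (k : ℤ) : ℤ :=
  if w.i ≤ k then w.i + (k - w.i) % w.l
  else if k < -w.i' then -w.i' - ((-w.i' - k - 1) % w.l') - 1
  else k

theorem fold_mem (k : ℤ) : w.fold k ∈ Set.Ico (-(w.i' : ℤ) - w.l') (w.i + w.l) := by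
  have h₁ : (0 : ℤ) < w.l := by exact_mod_cast w.l_pos
  have h₂ : (0 : ℤ) < w.l' := by exact_mod_cast w.l'_pos
  have h₃ := Int.emod_nonneg (k - w.i) h₁.ne'
  have h₄ := Int.emod_lt_of_pos (k - w.i) h₁
  have h₅ := Int.emod_nonneg (-w.i' - k - 1) h₂.ne'
  have h₆ := Int.emod_lt_of_pos (-w.i' - k - 1) h₂
  rw [fold, Set.mem_Ico]
  split_ifs <;> omega

theorem emod_add_one_cases (a : ℤ) {l : ℤ} (hl : 0 < l) :
    (a + 1) % l = a % l + 1 ∨ ((a + 1) % l = 0 ∧ a % l + 1 = l) := by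
  have h₁ := Int.emod_nonneg a hl.ne'
  have h₂ := Int.emod_lt_of_pos a hl
  have h₃ : (a + 1) % l = (a % l + 1) % l := by simp
  rcases (show a % l + 1 ≤ l by omega).lt_or_eq with h | h
  · exact .inl (by rw [h₃, Int.emod_eq_of_lt (by omega) h])
  · exact .inr ⟨by rw [h₃, h, Int.emod_self], h⟩

/-- The moment at position `k`, as a total function. -/
noncomputable def momAt (k : ℤ) : Moment Sg :=
  if h : k ∈ Set.Icc (-(w.i' : ℤ) - w.l') (w.i + w.l) then w.mom ⟨k, h⟩
  else w.mom ⟨0, by constructor <;> omega⟩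

/-- The relation at position `k`, as a total function. -/
def relAt (k : ℤ) (Φ Ψ : Set Formula) : Prop :=
  ∃ h : k ∈ Set.Ico (-(w.i' : ℤ) - w.l') (w.i + w.l), w.rel ⟨k, h⟩ Φ Ψ

theorem momAt_eq {k : ℤ} (h : k ∈ Set.Icc (-(w.i' : ℤ) - w.l') (w.i + w.l)) :
    w.momAt k = w.mom ⟨k, h⟩ := dif_pos h

theorem relAt_eq {k : ℤ} (h : k ∈ Set.Ico (-(w.i' : ℤ) - w.l') (w.i + w.l)) :
    w.relAt k = w.rel ⟨k, h⟩ := by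
  ext Φ Ψ
  exact ⟨fun h => h.2, fun h' => ⟨h, h'⟩⟩

theorem isTemporalStep_fold (k : ℤ) :
    IsTemporalStep (w.momAt (w.fold k)) (w.momAt (w.fold k + 1)) (w.relAt (w.fold k)) := by
  have h := w.fold_mem k
  rw [w.relAt_eq h, w.momAt_eq ⟨h.1, h.2.le⟩, w.momAt_eq (by constructor <;> grind)]
  exact w.step _ h.1 h.2

theorem momAt_past_loop : w.momAt (-w.i') = w.momAt (-w.i' - w.l') := by
  rw [w.momAt_eq (by constructor <;> omega), w.momAt_eq (by constructor <;> omega)]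
  exact w.past_loop

theorem momAt_future_loop : w.momAt w.i = w.momAt (w.i + w.l) := by
  rw [w.momAt_eq (by constructor <;> omega), w.momAt_eq (by constructor <;> omega)]
  exact w.future_loop

/-- `fold` commutes with the successor except where a loop wraps around, and there the two positions
carry the same moment by the loop conditions. -/
theorem momAt_fold_add_one (k : ℤ) : w.momAt (w.fold k + 1) = w.momAt (w.fold (k + 1)) := by
  have h₁ : (0 : ℤ) < w.l := by exact_mod_cast w.l_pos
  have h₂ : (0 : ℤ) < w.l' := by exact_mod_cast w.l'_pos
  rcases le_or_gt (w.i : ℤ) k with hi | hi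
  · have e : k + 1 - w.i = k - w.i + 1 := by ring
    rw [fold, fold, if_pos hi, if_pos (by omega), e]
    rcases emod_add_one_cases (k - w.i) h₁ with h | ⟨h, h'⟩
    · rw [h, add_assoc]
    · rw [h, add_assoc, h', add_zero, w.momAt_future_loop]
  rcases lt_or_ge k (-w.i') with hi' | hi'
  · rcases (show k + 1 ≤ -w.i' by omega).lt_or_eq with hk | hk
    · have e : -(w.i' : ℤ) - k - 1 = -w.i' - (k + 1) - 1 + 1 := by ring
      rw [fold, fold, if_neg hi.not_ge, if_pos hi', if_neg (by omega), if_pos hk, e]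
      rcases emod_add_one_cases (-w.i' - (k + 1) - 1) h₂ with h | ⟨h, h'⟩
      · rw [h]; congr 1; ring
      · rw [h, sub_sub _ (_ % _) (1 : ℤ), h']; simpa using w.momAt_past_loop
    · have e : -(w.i' : ℤ) - k - 1 = 0 := by omega
      rw [fold, if_neg hi.not_ge, if_pos hi', e, Int.zero_emod, fold, hk]
      split_ifs with hs
      · have : (w.i : ℤ) = 0 ∧ (w.i' : ℤ) = 0 := by omega
        simp [this]
      · omega
      · simp
  · rw [fold, if_neg hi.not_ge, if_neg hi'.not_gt, fold]
    split_ifs with hs hs'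
    · rw [show k + 1 = w.i by omega]; simp
    · omega
    · rfl

theorem fold_future (c : ℕ) {r : ℕ} (hr : r < w.l) :
    w.fold (w.i + c * w.l + r) = w.i + r := by
  have e : (w.i + c * w.l + r - w.i : ℤ) = r + w.l * c := by ring
  have h : (0 : ℤ) ≤ c * w.l := by positivity
  rw [fold, if_pos (by omega), e, Int.add_mul_emod_self_left,
    Int.emod_eq_of_lt (by omega) (by omega)]

theorem fold_past (c : ℕ) {r : ℕ} (hr : r < w.l') :
    w.fold (-w.i' - c * w.l' - r - 1) = -w.i' - r - 1 := by
  have e : (-w.i' - (-w.i' - c * w.l' - r - 1) - 1 : ℤ) = r + w.l' * c := by ring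
  have h : (0 : ℤ) ≤ c * w.l' := by positivity
  rw [fold, if_neg (by omega), if_pos (by omega), e, Int.add_mul_emod_self_left,
    Int.emod_eq_of_lt (by omega) (by omega)]

theorem fold_zero : w.fold 0 = 0 := by
  rw [fold]
  split_ifs with h h'
  · have : (w.i : ℤ) = 0 := by omega
    simp [this]
  · omega
  · rfl

theorem momAt_fold_future (c : ℕ) : w.momAt (w.fold (w.i + c * w.l)) = w.momAt w.i := by
  simpa using congrArg w.momAt (w.fold_future c w.l_pos)

/-- For `c > 0` this time folds to the left end of the past loop rather than to `-i'`. The moment is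
therefore computed as the right end of the preceding step. -/
theorem momAt_fold_past (c : ℕ) : w.momAt (w.fold (-w.i' - c * w.l')) = w.momAt (-w.i') := by
  have h := w.momAt_fold_add_one (-w.i' - c * w.l' - (0 : ℕ) - 1)
  rw [w.fold_past c w.l'_pos] at h
  simpa using h.symm

theorem future_realised {Φ : Set Formula} (hΦ : Φ ∈ (w.momAt w.i).carrier) {o : Formula}
    (ho : FuturePending Sg o Φ) : ∃ r < w.l, ∃ P : ℕ → Set Formula, P 0 = Φ ∧
      (∀ k < r, w.relAt (w.i + k) (P k) (P (k + 1))) ∧ Fulfilled o (P r) := by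
  rw [w.momAt_eq (by constructor <;> omega)] at hΦ
  cases o with
  | U α β =>
    obtain ⟨r, hr, P, h₀, h₁, h₂⟩ := w.until_realised Φ hΦ α β ho
    exact ⟨r, hr, P, h₀, fun k hk => ⟨_, (h₁ k hk).1⟩, h₂⟩
  | G β =>
    obtain ⟨r, hr, P, h₀, h₁, h₂⟩ := w.G_realised Φ hΦ β ho
    exact ⟨r, hr, P, h₀, fun k hk => ⟨_, h₁ k hk⟩, h₂⟩
  | _ => exact ho.elim

theorem past_realised {Φ : Set Formula} (hΦ : Φ ∈ (w.momAt (-w.i')).carrier) {o : Formula}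
    (ho : PastPending Sg o Φ) : ∃ r < w.l', ∃ P : ℕ → Set Formula, P 0 = Φ ∧
      (∀ k < r, w.relAt (-w.i' - k - 1) (P (k + 1)) (P k)) ∧ Fulfilled o (P r) := by
  rw [w.momAt_eq (by constructor <;> omega)] at hΦ
  cases o with
  | S α β =>
    obtain ⟨r, hr, P, h₀, h₁, h₂⟩ := w.since_realised Φ hΦ α β ho
    exact ⟨r, hr, P, h₀, fun k hk => ⟨_, (h₁ k hk).1⟩, h₂⟩
  | H β =>
    obtain ⟨r, hr, P, h₀, h₁, h₂⟩ := w.H_realised Φ hΦ β ho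
    exact ⟨r, hr, P, h₀, fun k hk => ⟨_, h₁ k hk⟩, h₂⟩
  | _ => exact ho.elim

/-- The bi-infinite sequence of moments obtained by repeating the two loops of a witness. -/
noncomputable def unroll : UnrolledWitness Sg where
  mom k := w.momAt (w.fold k)
  rel k := w.relAt (w.fold k)
  step k := by
    rw [← w.momAt_fold_add_one]
    exact w.isTemporalStep_fold k
  future K₀ := by
    have hl : (1 : ℤ) ≤ w.l := by exact_mod_cast w.l_pos
    refine ⟨w.i + K₀.toNat * w.l, by nlinarith [Int.self_le_toNat K₀], fun Φ hΦ o ho => ?_⟩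
    rw [w.momAt_fold_future] at hΦ
    obtain ⟨r, hr, P, h₀, h₁, h₂⟩ := w.future_realised hΦ ho
    refine ⟨r, P, h₀, fun k hk => ?_, h₂⟩
    rw [w.fold_future _ (hk.trans hr)]
    exact h₁ k hk
  past K₀ := by
    have hl : (1 : ℤ) ≤ w.l' := by exact_mod_cast w.l'_pos
    refine ⟨-w.i' - (-K₀).toNat * w.l', by nlinarith [Int.self_le_toNat (-K₀)],
      fun Φ hΦ o ho => ?_⟩
    rw [w.momAt_fold_past] at hΦ
    obtain ⟨r, hr, P, h₀, h₁, h₂⟩ := w.past_realised hΦ ho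
    refine ⟨r, P, h₀, fun k hk => ?_, h₂⟩
    rw [w.fold_past _ (hk.trans hr)]
    exact h₁ k hk

theorem unroll_falsifies : ∃ Φ ∈ (w.unroll.mom 0).carrier, φ ∉ Φ := by
  simp only [unroll, w.fold_zero, w.momAt_eq (k := 0) (by constructor <;> omega)]
  exact w.falsifies

end SmallWitness

/-! ### Threads of an unrolled witness -/

namespace IsTemporalStep

variable {Sg : Set Formula} {m n : Moment Sg} {R : Set Formula → Set Formula → Prop}
  (h : IsTemporalStep m n R)
include h

/-- One related pair suffices: every index is comparable with its left end, and confluence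
transports the pair downwards or upwards. -/
theorem exists_right (a : Fin (m.top + 1)) : ∃ b, R (m.lab a) (n.lab b) := by
  obtain ⟨Φ, Ψ, hR⟩ := h.nonempty
  obtain ⟨⟨a', rfl⟩, b', rfl⟩ := h.subset _ _ hR
  rcases le_total a a' with ha | ha
  · obtain ⟨b, hb, -⟩ := h.confluent.forth_down a a' b' ha hR
    exact ⟨b, hb⟩
  · obtain ⟨b, hb, -⟩ := h.confluent.forth_up a' a b' ha hR
    exact ⟨b, hb⟩

theorem exists_left (b : Fin (n.top + 1)) : ∃ a, R (m.lab a) (n.lab b) := by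
  obtain ⟨Φ, Ψ, hR⟩ := h.nonempty
  obtain ⟨⟨a', rfl⟩, b', rfl⟩ := h.subset _ _ hR
  rcases le_total b b' with hb | hb
  · obtain ⟨a, -, ha⟩ := h.confluent.back_down a' b b' hR hb
    exact ⟨a, ha⟩
  · obtain ⟨a, -, ha⟩ := h.confluent.back_up a' b' b hR hb
    exact ⟨a, ha⟩

/-- Confluence relates `a` to some `c ≤ b'`, and `a` is also related to `b ≥ b'`; convexity of the
image of `a` fills in `b'`. The other pair is dual. -/
theorem uncross {a a' : Fin (m.top + 1)} {b b' : Fin (n.top + 1)}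
    (h₁ : R (m.lab a) (n.lab b)) (h₂ : R (m.lab a') (n.lab b')) (ha : a ≤ a') (hb : b' ≤ b) :
    R (m.lab a) (n.lab b') ∧ R (m.lab a') (n.lab b) := by
  obtain ⟨c, hc, hcb⟩ := h.confluent.forth_down a a' b' ha h₂
  obtain ⟨d, hd, hdb⟩ := h.confluent.forth_up a a' b ha h₁
  exact ⟨(h.convex.image a).out hc h₁ ⟨hcb, hb⟩, (h.convex.image a').out h₂ hd ⟨hb, hdb⟩⟩

end IsTemporalStep

/-- The type with index `x` in `m`, and the last type if there is no such index. -/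
def Moment.labAt {Sg : Set Formula} (m : Moment Sg) (x : ℕ) : Set Formula :=
  m.lab ⟨min x m.top, by omega⟩

theorem Moment.labAt_val {Sg : Set Formula} (m : Moment Sg) (a : Fin (m.top + 1)) :
    m.labAt a = m.lab a := by
  rw [labAt]
  congr 1
  ext
  exact min_eq_left (by omega)

theorem Moment.labAt_eq {Sg : Set Formula} (m : Moment Sg) {x : ℕ} (h : x < m.top + 1) :
    m.labAt x = m.lab ⟨x, h⟩ := m.labAt_val ⟨x, h⟩

theorem Moment.labAt_anti {Sg : Set Formula} (m : Moment Sg) : Antitone m.labAt := by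
  intro x y h
  exact m.lab_subset_iff.2 (min_le_min_right _ h)

namespace UnrolledWitness

variable {Sg : Set Formula} (U : UnrolledWitness Sg)

/-- The thread system of the indices of the types in an unrolled witness. -/
def threadSystem : ThreadSystem where
  D k := {x | x < (U.mom k).top + 1}
  R k x y := x < (U.mom k).top + 1 ∧ y < (U.mom (k + 1)).top + 1 ∧
    U.rel k ((U.mom k).labAt x) ((U.mom (k + 1)).labAt y)
  mem_left h := h.1
  mem_right h := h.2.1
  serial k x hx := by
    obtain ⟨b, hb⟩ := (U.step k).exists_right ⟨x, hx⟩
    exact ⟨b, hx, b.2, by rwa [Moment.labAt_val, Moment.labAt_eq _ hx]⟩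
  coserial k y hy := by
    obtain ⟨a, ha⟩ := (U.step k).exists_left ⟨y, hy⟩
    exact ⟨a, a.2, hy, by rwa [Moment.labAt_val, Moment.labAt_eq _ hy]⟩
  uncross := by
    rintro k x x' y y' ⟨hx, hy, h⟩ ⟨hx', hy', h'⟩ hxx hyy
    rw [Moment.labAt_eq _ hx, Moment.labAt_eq _ hy] at h
    rw [Moment.labAt_eq _ hx', Moment.labAt_eq _ hy'] at h'
    have := (U.step k).uncross h h' hxx hyy
    refine ⟨⟨hx, hy', ?_⟩, hx', hy, ?_⟩
    · rw [Moment.labAt_eq _ hx, Moment.labAt_eq _ hy']; exact this.1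
    · rw [Moment.labAt_eq _ hx', Moment.labAt_eq _ hy]; exact this.2

theorem isType_labAt (k : ℤ) (x : ℕ) : IsType Sg ((U.mom k).labAt x) := (U.mom k).isType _

theorem sensible_of_R {k : ℤ} {x y : ℕ} (h : U.threadSystem.R k x y) :
    Sensible Sg ((U.mom k).labAt x) ((U.mom (k + 1)).labAt y) :=
  (U.step k).sensible _ _ h.2.2

/-- The future eventualities of an unrolled witness. -/
def futureEventualities : U.threadSystem.Eventualities Sg where
  pend o k x := FuturePending Sg o ((U.mom k).labAt x)
  done o k x := Fulfilled o ((U.mom k).labAt x)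
  persist hR h := (h.persist (U.isType_labAt _ _).subset (U.sensible_of_R hR)).imp id And.right

/-- The past eventualities of an unrolled witness. -/
def pastEventualities : U.threadSystem.reverse.Eventualities Sg where
  pend o k x := PastPending Sg o ((U.mom (-k)).labAt x)
  done o k x := Fulfilled o ((U.mom (-k)).labAt x)
  persist {o k x y} hR h := by
    have hR' : U.threadSystem.R (-k - 1) y x := hR
    have hs := U.sensible_of_R hR'
    rw [sub_add_cancel] at hs
    rw [neg_add']
    exact (h.persist (U.isType_labAt _ _).subset hs).imp id And.right

theorem exists_indices (τ : ℕ → ℤ) {x : ℕ} (hx : x ∈ U.threadSystem.D (τ 0)) {r : ℕ}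
    {P : ℕ → Set Formula} (h₀ : P 0 = (U.mom (τ 0)).labAt x)
    (hP : ∀ k < r, P (k + 1) ∈ (U.mom (τ (k + 1))).carrier) :
    ∃ f : ℕ → ℕ, f 0 = x ∧ ∀ k ≤ r, f k < (U.mom (τ k)).top + 1 ∧
      (U.mom (τ k)).labAt (f k) = P k := by
  have (k : ℕ) : ∃ y, (k = 0 → y = x) ∧
      (k ≤ r → y < (U.mom (τ k)).top + 1 ∧ (U.mom (τ k)).labAt y = P k) := by
    rcases k with _ | k
    · exact ⟨x, fun _ => rfl, fun _ => ⟨hx, h₀.symm⟩⟩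
    · by_cases hkr : k < r
      · obtain ⟨a, ha⟩ := hP k hkr
        exact ⟨a, by omega, fun _ => ⟨a.2, by rw [Moment.labAt_val, ha]⟩⟩
      · exact ⟨0, by omega, fun h => absurd h hkr⟩
  choose f h₁ h₂ using this
  exact ⟨f, h₁ 0 rfl, h₂⟩

/-- Follow any thread to a later time `K` at which realisation is guaranteed. If the debt is still
open there, leave the thread for the path that pays it. -/
theorem exists_thread_future (o : Sg) (k : ℤ) (x : ℕ) (hx : x ∈ U.threadSystem.D k)
    (ho : U.futureEventualities.pend o k x) : ∃ p, U.threadSystem.IsThread p ∧ p k = x ∧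
      ∃ n ≥ k, U.futureEventualities.done o n (p n) := by
  obtain ⟨p, hp, rfl⟩ := ThreadSystem.exists_thread hx
  obtain ⟨K, hK, hfut⟩ := U.future k
  rcases hp.done_or_pend hK ho with ⟨n, hn, -, h⟩ | hpend
  · exact ⟨p, hp, rfl, n, hn, h⟩
  have hmem := hp.mem K
  obtain ⟨r, P, h₀, hstep, hr⟩ := hfut _ ⟨_, rfl⟩ o hpend
  obtain ⟨f, hf₀, hf⟩ := U.exists_indices (fun j => K + j) (x := p K) (r := r) (P := P)
    (by simpa using hmem)
    (by simpa using (show P 0 = (U.mom K).labAt (p K) from h₀)) fun j hj => by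
      have := ((U.step _).subset _ _ (hstep j (by omega))).2
      rwa [add_assoc] at this
  obtain ⟨q, hq, hqf⟩ := ThreadSystem.exists_thread_extending (A := U.threadSystem) (k := K) f
    (by rwa [hf₀]) r fun j hj => by
      have h₁ := hf j hj.le
      have h₂ := hf (j + 1) hj
      simp only [Nat.cast_succ, ← add_assoc] at h₂
      exact ⟨h₁.1, h₂.1, by rw [h₁.2, h₂.2]; exact hstep j hj⟩
  have hpq : p K = q K := by simpa [hf₀] using (hqf 0 r.zero_le).symm
  refine ⟨_, hp.glue hq hpq, ThreadSystem.glue_of_le hK, K + r, by omega, ?_⟩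
  rw [ThreadSystem.glue_of_ge hpq (by omega), hqf r le_rfl]
  change Fulfilled _ _
  rwa [(hf r le_rfl).2]

theorem exists_thread_past (o : Sg) (k : ℤ) (x : ℕ) (hx : x ∈ U.threadSystem.reverse.D k)
    (ho : U.pastEventualities.pend o k x) : ∃ p, U.threadSystem.reverse.IsThread p ∧ p k = x ∧
      ∃ n ≥ k, U.pastEventualities.done o n (p n) := by
  obtain ⟨p, hp, rfl⟩ := ThreadSystem.exists_thread hx
  obtain ⟨K, hK, hpast⟩ := U.past (-k)
  -- From here `K` is measured in reversed time, so that going back in the witness is going forward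
  -- along the thread.
  obtain ⟨K, rfl⟩ : ∃ K', K = -K' := ⟨-K, by simp⟩
  replace hK : k ≤ K := by omega
  rcases hp.done_or_pend hK ho with ⟨n, hn, -, h⟩ | hpend
  · exact ⟨p, hp, rfl, n, hn, h⟩
  have hmem := hp.mem K
  obtain ⟨r, P, h₀, hstep, hr⟩ := hpast _ ⟨_, rfl⟩ o hpend
  simp only [← neg_add'] at hstep
  obtain ⟨f, hf₀, hf⟩ := U.exists_indices (fun j => -(K + j)) (x := p K) (r := r) (P := P)
    (by simpa using (show p K ∈ U.threadSystem.D (-K) from hmem))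
    (by simpa using (show P 0 = (U.mom (-K)).labAt (p K) from h₀)) fun j hj => by
      have := ((U.step _).subset _ _ (hstep j (by omega))).1
      rwa [add_assoc] at this
  obtain ⟨q, hq, hqf⟩ := ThreadSystem.exists_thread_extending (A := U.threadSystem.reverse)
    (k := K) f (by rwa [hf₀]) r fun j hj => by
      have h₁ := hf j hj.le
      have h₂ := hf (j + 1) hj
      simp only [Nat.cast_succ, ← add_assoc] at h₂
      have h := hstep j hj
      rw [← h₁.2, ← h₂.2] at h
      have e : -(K + j : ℤ) = -(K + j + 1) + 1 := by ring
      simp only [e] at h h₁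
      have hR : U.threadSystem.R (-(K + j + 1)) (f (j + 1)) (f j) := ⟨h₂.1, h₁.1, h⟩
      rw [neg_add'] at hR
      exact hR
  have hpq : p K = q K := by simpa [hf₀] using (hqf 0 r.zero_le).symm
  refine ⟨_, hp.glue hq hpq, ThreadSystem.glue_of_le hK, K + r, by omega, ?_⟩
  rw [ThreadSystem.glue_of_ge hpq (by omega), hqf r le_rfl]
  change Fulfilled _ _
  rwa [(hf r le_rfl).2]

/-- A thread with the right future and one with the right past are joined at the point; each
condition looks at one tail only. -/
theorem exists_good (hfin : Sg.Finite) (k : ℤ) (x : ℕ) (hx : x ∈ U.threadSystem.D k) :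
    ∃ p, ThreadSystem.IsGood U.futureEventualities U.pastEventualities p ∧ p k = x := by
  have := hfin.countable.to_subtype
  obtain ⟨p, hp, hpk, hpf⟩ := ThreadSystem.exists_fulfilling_thread U.exists_thread_future hx
  obtain ⟨q, hq, hqk, hqf⟩ := ThreadSystem.exists_fulfilling_thread U.exists_thread_past
    (k₀ := -k) (x₀ := x) (by simpa [ThreadSystem.reverse] using hx)
  have heq : q (-k) = p k := by rw [hpk, hqk]
  have hg := hq.of_reverse.glue hp heq
  refine ⟨_, ⟨hg, hg.fulfils_of_eq hpf k fun j hj => ThreadSystem.glue_of_ge heq hj,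
    hg.reverse.fulfils_of_eq hqf (-k) fun j hj => ?_⟩, ?_⟩
  · rw [ThreadSystem.glue_of_le (by omega), neg_neg]
  · rw [ThreadSystem.glue_of_le le_rfl, hqk]

end UnrolledWitness

namespace TypeFlow

variable {Sg : Set Formula} {W : Type*} [LinearOrder W] (F : TypeFlow Sg W)

/-- Each eventuality owed at `(k, w)` is realised along `w` itself. -/
structure Exact : Prop where
  future : ∀ o k w, FuturePending Sg o (F.ty k w) → F.FutureRealises o k w
  past : ∀ o k w, PastPending Sg o (F.ty k w) → F.PastRealises o k w

/-- Sensibility forces the left argument of an until-formula to hold while the debt is open. This is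
why threads only need to track fulfilment. -/
theorem futureRealises_of_fulfilled {o : Formula} {w : W} {k : ℤ}
    (h : FuturePending Sg o (F.ty k w)) (hd : ∃ n ≥ k, Fulfilled o (F.ty n w)) :
    F.FutureRealises o k w := by
  obtain ⟨_, hn, hd⟩ := hd
  obtain ⟨n, rfl⟩ := Int.le.dest hn
  clear hn
  induction n generalizing k with
  | zero => exact ⟨0, by simp, hd⟩
  | succ n ih =>
    rcases h.persist (F.isType k w).subset (F.sensible k w) with h' | ⟨hh, h'⟩
    · exact ⟨0, by simp, by simpa using h'⟩
    · have e (j : ℕ) : k + (j + 1 : ℕ) = k + 1 + j := by push_cast; ring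
      obtain ⟨r, h₁, h₂⟩ := ih h' (by rwa [← e])
      refine ⟨r + 1, fun j hj => ?_, by rwa [e]⟩
      rcases j with _ | j
      · simpa using hh
      · rw [e]; exact h₁ j (by omega)

theorem pastRealises_of_fulfilled {o : Formula} {w : W} {k : ℤ}
    (h : PastPending Sg o (F.ty k w)) (hd : ∃ n ≤ k, Fulfilled o (F.ty n w)) :
    F.PastRealises o k w := by
  obtain ⟨m, hm, hd⟩ := hd
  obtain ⟨n, rfl⟩ : ∃ n : ℕ, m = k - n := ⟨(k - m).toNat, by omega⟩
  clear hm
  induction n generalizing k with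
  | zero => exact ⟨0, by simp, hd⟩
  | succ n ih =>
    have hs := F.sensible (k - 1) w
    rw [sub_add_cancel] at hs
    rcases h.persist (F.isType k w).subset hs with h' | ⟨hh, h'⟩
    · exact ⟨0, by simp, by simpa using h'⟩
    · have e (j : ℕ) : k - (j + 1 : ℕ) = k - 1 - j := by push_cast; ring
      obtain ⟨r, h₁, h₂⟩ := ih h' (by rwa [← e])
      refine ⟨r + 1, fun j hj => ?_, by rwa [e]⟩
      rcases j with _ | j
      · simpa using hh
      · rw [e]; exact h₁ j (by omega)

end TypeFlow

/-- A witness unrolls to a flow of types over a countable linear order in which all eventualities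
are realised. -/
theorem SmallWitness.exists_typeFlow {Sg : Set Formula} (hfin : Sg.Finite) {φ : Formula}
    (w : SmallWitness Sg φ) : ∃ (W : Type) (_ : LinearOrder W) (_ : Countable W)
      (F : TypeFlow Sg W), F.Exact ∧ ∃ w₀, φ ∉ F.ty 0 w₀ := by
  classical
  let U := w.unroll
  obtain ⟨C, hcount, hchain, hgood, hcover⟩ :=
    ThreadSystem.exists_countable_chain (U.exists_good hfin)
  let L : LinearOrder C := { (inferInstance : PartialOrder C) with
    le_total := fun a b => hchain.total a.2 b.2
    toDecidableLE := Classical.decRel _ }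
  have hC (p : C) := hgood p.1 p.2
  have cover (k : ℤ) (a : Fin ((U.mom k).top + 1)) : ∃ p : C, p.1 k = a := by
    obtain ⟨p, hp, hpa⟩ := hcover k a a.2
    exact ⟨⟨p, hp⟩, hpa⟩
  -- Strict inequality at a single time decides the order of two members of the chain. With equal
  -- indices, a thread given by `cover` may lie on either side of `p`; hence a defect at the index
  -- of `p` is witnessed by `p` itself.
  have le_of {k : ℤ} {p v : C} (h : v.1 k < p.1 k) : v ≤ p :=
    (hchain.total v.2 p.2).resolve_right fun h' => absurd (h' k) h.not_ge
  let F : TypeFlow Sg C := {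
    ty := fun k p => (U.mom k).labAt (p.1 k)
    anti := fun k p q h => (U.mom k).labAt_anti (h k)
    isType := fun k p => U.isType_labAt k _
    imp_defect := by
      intro k p φ ψ h
      have hp : p.1 k < _ := (hC p).isThread.mem k
      rw [Moment.labAt_eq _ hp] at h
      obtain ⟨a, ha, hφ⟩ := (U.mom k).imp_defect _ φ ψ h
      rcases ha.eq_or_lt with rfl | ha
      · exact ⟨p, le_rfl, by rwa [Moment.labAt_eq _ hp]⟩
      · obtain ⟨v, hv⟩ := cover k a
        exact ⟨v, le_of (k := k) (by rw [hv]; exact ha), by rwa [hv, Moment.labAt_val]⟩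
    coimp_defect := by
      intro k p φ ψ h
      have hp : p.1 k < _ := (hC p).isThread.mem k
      rw [Moment.labAt_eq _ hp] at h
      obtain ⟨a, ha, hφ⟩ := (U.mom k).coimp_defect _ φ ψ h
      rcases ha.le.eq_or_lt with rfl | ha
      · exact ⟨p, le_rfl, by rwa [Moment.labAt_eq _ hp]⟩
      · obtain ⟨v, hv⟩ := cover k a
        exact ⟨v, le_of (k := k) (by rw [hv]; exact ha), by rwa [hv, Moment.labAt_val]⟩
    sensible := fun k p => U.sensible_of_R ((hC p).isThread k) }
  refine ⟨C, L, hcount.to_subtype, F, ⟨fun o k p h => ?_, fun o k p h => ?_⟩, ?_⟩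
  · exact F.futureRealises_of_fulfilled h
      ((hC p).future ⟨o, h.mem (F.isType k p).subset⟩ k h)
  · have h' : U.pastEventualities.pend ⟨o, h.mem (F.isType k p).subset⟩ (-k)
        (p.1 (- -k)) := by
      simpa [UnrolledWitness.pastEventualities] using h
    obtain ⟨n, hn, hd⟩ := (hC p).past _ _ h'
    exact F.pastRealises_of_fulfilled h ⟨-n, by omega, hd⟩
  · obtain ⟨_, ⟨a, rfl⟩, hφ⟩ := w.unroll_falsifies
    obtain ⟨p, hp⟩ := cover 0 a
    refine ⟨p, ?_⟩
    change φ ∉ (U.mom 0).labAt (p.1 0)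
    rwa [hp, Moment.labAt_val]

/-! ### From exact flows of types to bi-relational models -/

/-- The truth set of a formula for a given interpretation of the variables. -/
def eval {W : Type*} [LinearOrder W] {T : Type*} (S : Equiv.Perm T) (I : ℕ → Set (W × T)) :
    Formula → Set (W × T)
  | .var p => I p
  | .and φ ψ => eval S I φ ∩ eval S I ψ
  | .or φ ψ => eval S I φ ∪ eval S I ψ
  | .imp φ ψ => {x | ∀ v ≤ x.1, (v, x.2) ∈ eval S I φ → (v, x.2) ∈ eval S I ψ}
  | .coimp φ ψ => {x | ∃ v ≥ x.1, (v, x.2) ∈ eval S I φ ∧ (v, x.2) ∉ eval S I ψ}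
  | .X φ => step W S ⁻¹' eval S I φ
  | .Y φ => step W S '' eval S I φ
  | .G φ => ⋂ n : ℕ, (step W S)^[n] ⁻¹' eval S I φ
  | .H φ => ⋂ n : ℕ, (step W S)^[n] '' eval S I φ
  | .U φ ψ => ⋃ n : ℕ, (⋂ k < n, (step W S)^[k] ⁻¹' eval S I φ) ∩ (step W S)^[n] ⁻¹' eval S I ψ
  | .S φ ψ => ⋃ n : ℕ, (⋂ k < n, (step W S)^[k] '' eval S I φ) ∩ (step W S)^[n] '' eval S I ψ

/-- The bi-relational valuation extending an interpretation of the variables by downward closed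
sets. -/
def evalValuation {W : Type*} [LinearOrder W] {T : Type*} (S : Equiv.Perm T) (I : ℕ → Set (W × T))
    (hI : ∀ p w v t, v ≤ w → (w, t) ∈ I p → (v, t) ∈ I p) : RelValuation W S where
  val := eval S I
  var_down := hI
  and_eq _ _ := rfl
  or_eq _ _ := rfl
  imp_eq _ _ := rfl
  coimp_eq _ _ := rfl
  X_eq _ := rfl
  Y_eq _ := rfl
  G_eq _ := rfl
  H_eq _ := rfl
  U_eq _ _ := rfl
  S_eq _ _ := rfl

/-- The flow of the integers with the successor map. -/
def intShift : Equiv.Perm (ULift.{u} ℤ) where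
  toFun k := ⟨k.down + 1⟩
  invFun k := ⟨k.down - 1⟩
  left_inv k := by ext; simp
  right_inv k := by ext; simp

theorem intShift_apply (k : ULift.{u} ℤ) : intShift k = ⟨k.down + 1⟩ := rfl

theorem intShift_inv_apply (k : ULift.{u} ℤ) : intShift⁻¹ k = ⟨k.down - 1⟩ := rfl

theorem intShift_pow_apply (n : ℕ) (k : ULift.{u} ℤ) : (intShift ^ n) k = ⟨k.down + n⟩ := by
  induction n with
  | zero => ext; simp
  | succ n ih =>
    rw [pow_succ', Equiv.Perm.mul_apply, ih, intShift_apply]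
    ext
    push_cast
    ring

theorem intShift_inv_pow_apply (n : ℕ) (k : ULift.{u} ℤ) :
    (intShift⁻¹ ^ n) k = ⟨k.down - n⟩ := by
  induction n with
  | zero => ext; simp
  | succ n ih =>
    rw [pow_succ', Equiv.Perm.mul_apply, ih, intShift_inv_apply]
    ext
    push_cast
    ring

namespace TypeFlow

variable {Sg : Set Formula} {W : Type*} [LinearOrder W] (F : TypeFlow Sg W)

/-- The bi-relational valuation on the integers defined by a flow of types. -/
def relValuation : RelValuation W intShift.{u} :=
  evalValuation intShift (fun p => {x | Formula.var p ∈ F.ty x.2.down x.1})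
    fun _ _ _ t h hx => F.anti t.down h hx

theorem G_mem_iff (hF : F.Exact) {β : Formula} (h : Formula.G β ∈ Sg) (k : ℤ) (w : W) :
    .G β ∈ F.ty k w ↔ ∀ n : ℕ, β ∈ F.ty (k + n) w := by
  constructor
  · intro hG n
    have key : .G β ∈ F.ty (k + n) w := by
      induction n with
      | zero => simpa using hG
      | succ n ih =>
        rw [Nat.cast_succ, ← add_assoc]
        exact (((F.sensible _ w).G_iff β h).1 ih).2
    exact (((F.sensible _ w).G_iff β h).1 key).1
  · intro hβ
    by_contra hG
    obtain ⟨r, -, hr⟩ := hF.future (.G β) k w ⟨h, hG⟩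
    exact hr (hβ r)

theorem H_mem_iff (hF : F.Exact) {β : Formula} (h : Formula.H β ∈ Sg) (k : ℤ) (w : W) :
    .H β ∈ F.ty k w ↔ ∀ n : ℕ, β ∈ F.ty (k - n) w := by
  have hs (k : ℤ) : .H β ∈ F.ty k w → β ∈ F.ty k w ∧ .H β ∈ F.ty (k - 1) w := by
    have := (F.sensible (k - 1) w).H_iff β h
    rw [sub_add_cancel] at this
    exact this.1
  constructor
  · intro hH n
    have key : .H β ∈ F.ty (k - n) w := by
      induction n with
      | zero => simpa using hH
      | succ n ih =>
        rw [Nat.cast_succ, ← sub_sub]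
        exact (hs _ ih).2
    exact (hs _ key).1
  · intro hβ
    by_contra hH
    obtain ⟨r, -, hr⟩ := hF.past (.H β) k w ⟨h, hH⟩
    exact hr (hβ r)

theorem U_mem_iff (hF : F.Exact) {α β : Formula} (h : Formula.U α β ∈ Sg) (k : ℤ) (w : W) :
    .U α β ∈ F.ty k w ↔ ∃ n : ℕ, (∀ j < n, α ∈ F.ty (k + j) w) ∧ β ∈ F.ty (k + n) w := by
  refine ⟨fun hU => hF.future (.U α β) k w hU, ?_⟩
  rintro ⟨n, hα, hβ⟩
  induction n generalizing k with
  | zero => exact ((F.sensible k w).U_iff α β h).2 (.inl (by simpa using hβ))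
  | succ n ih =>
    have e (j : ℕ) : k + (j + 1 : ℕ) = k + 1 + j := by push_cast; ring
    refine ((F.sensible k w).U_iff α β h).2 (.inr ⟨by simpa using hα 0 n.succ_pos, ih _ ?_ ?_⟩)
    · intro j hj
      rw [← e]
      exact hα _ (by omega)
    · rwa [← e]

theorem S_mem_iff (hF : F.Exact) {α β : Formula} (h : Formula.S α β ∈ Sg) (k : ℤ) (w : W) :
    .S α β ∈ F.ty k w ↔ ∃ n : ℕ, (∀ j < n, α ∈ F.ty (k - j) w) ∧ β ∈ F.ty (k - n) w := by
  refine ⟨fun hS => hF.past (.S α β) k w hS, ?_⟩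
  rintro ⟨n, hα, hβ⟩
  induction n generalizing k with
  | zero =>
    have := (F.sensible (k - 1) w).S_iff α β h
    rw [sub_add_cancel] at this
    exact this.2 (.inl (by simpa using hβ))
  | succ n ih =>
    have e (j : ℕ) : k - (j + 1 : ℕ) = k - 1 - j := by push_cast; ring
    have := (F.sensible (k - 1) w).S_iff α β h
    rw [sub_add_cancel] at this
    refine this.2 (.inr ⟨by simpa using hα 0 n.succ_pos, ih _ ?_ ?_⟩)
    · intro j hj
      rw [← e]
      exact hα _ (by omega)
    · rwa [← e]

theorem imp_mem_iff {φ ψ : Formula} (h : Formula.imp φ ψ ∈ Sg) (k : ℤ) (w : W) :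
    .imp φ ψ ∈ F.ty k w ↔ ∀ v ≤ w, φ ∈ F.ty k v → ψ ∈ F.ty k v := by
  constructor
  · intro hm v hv hφ
    exact ((F.isType k v).imp_elim φ ψ h (F.anti k hv hm)).resolve_left (not_not.2 hφ)
  · intro hall
    by_contra hm
    obtain ⟨v, hv, hφ, hψ⟩ := F.imp_defect k w φ ψ ⟨h, hm⟩
    exact hψ (hall v hv hφ)

theorem coimp_mem_iff {φ ψ : Formula} (h : Formula.coimp φ ψ ∈ Sg) (k : ℤ) (w : W) :
    .coimp φ ψ ∈ F.ty k w ↔ ∃ v ≥ w, φ ∈ F.ty k v ∧ ψ ∉ F.ty k v := by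
  constructor
  · exact F.coimp_defect k w φ ψ
  · rintro ⟨v, hv, hφ, hψ⟩
    exact F.anti k hv ((F.isType k v).coimp_intro φ ψ h hφ hψ)

/-- The truth lemma. Sensibility settles `X` and `Y` and one half of the other modal cases;
exactness gives the half that needs a fulfilment time. -/
theorem mem_relValuation_iff (hsub : SubformulaClosed Sg) (hF : F.Exact) {φ : Formula}
    (hφ : φ ∈ Sg) (w : W) (t : ULift.{u} ℤ) :
    (w, t) ∈ F.relValuation.val φ ↔ φ ∈ F.ty t.down w := by
  induction φ generalizing w t with
  | var p => rfl
  | and φ ψ ihφ ihψ =>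
    rw [(F.relValuation).and_eq, (F.isType _ _).and_iff _ _ hφ, Set.mem_inter_iff,
      ihφ (hsub _ hφ (by simp [Formula.children])), ihψ (hsub _ hφ (by simp [Formula.children]))]
  | or φ ψ ihφ ihψ =>
    rw [(F.relValuation).or_eq, (F.isType _ _).or_iff _ _ hφ, Set.mem_union,
      ihφ (hsub _ hφ (by simp [Formula.children])), ihψ (hsub _ hφ (by simp [Formula.children]))]
  | imp φ ψ ihφ ihψ =>
    rw [(F.relValuation).imp_eq, F.imp_mem_iff hφ, Set.mem_ofPred_eq]
    simp only [ihφ (hsub _ hφ (by simp [Formula.children])),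
      ihψ (hsub _ hφ (by simp [Formula.children]))]
  | coimp φ ψ ihφ ihψ =>
    rw [(F.relValuation).coimp_eq, F.coimp_mem_iff hφ, Set.mem_ofPred_eq]
    simp only [ihφ (hsub _ hφ (by simp [Formula.children])),
      ihψ (hsub _ hφ (by simp [Formula.children]))]
  | X φ ih =>
    rw [(F.relValuation).mem_X, ih (hsub _ hφ (by simp [Formula.children])), intShift_apply,
      (F.sensible _ w).X_iff φ hφ]
  | Y φ ih =>
    rw [(F.relValuation).mem_Y, ih (hsub _ hφ (by simp [Formula.children])), intShift_inv_apply,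
      ← (F.sensible _ w).Y_iff φ hφ, sub_add_cancel]
  | G φ ih =>
    rw [(F.relValuation).mem_G, F.G_mem_iff hF hφ]
    simp only [ih (hsub _ hφ (by simp [Formula.children])), intShift_pow_apply]
  | H φ ih =>
    rw [(F.relValuation).mem_H, F.H_mem_iff hF hφ]
    simp only [ih (hsub _ hφ (by simp [Formula.children])), intShift_inv_pow_apply]
  | U φ ψ ihφ ihψ =>
    rw [(F.relValuation).mem_U, F.U_mem_iff hF hφ]
    simp only [ihφ (hsub _ hφ (by simp [Formula.children])),
      ihψ (hsub _ hφ (by simp [Formula.children])), intShift_pow_apply]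
  | S φ ψ ihφ ihψ =>
    rw [(F.relValuation).mem_S, F.S_mem_iff hF hφ]
    simp only [ihφ (hsub _ hφ (by simp [Formula.children])),
      ihψ (hsub _ hφ (by simp [Formula.children])), intShift_inv_pow_apply]

/-- A flow of types indexed by the lift of `W` to another universe. -/
def uliftFlow : TypeFlow Sg (ULift.{v} W) where
  ty k w := F.ty k w.down
  anti k _ _ h := F.anti k h
  isType k w := F.isType k w.down
  imp_defect k w φ ψ h := by
    obtain ⟨v, hv, h⟩ := F.imp_defect k w.down φ ψ h
    exact ⟨⟨v⟩, hv, h⟩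
  coimp_defect k w φ ψ h := by
    obtain ⟨v, hv, h⟩ := F.coimp_defect k w.down φ ψ h
    exact ⟨⟨v⟩, hv, h⟩
  sensible k w := F.sensible k w.down

theorem Exact.uliftFlow {F : TypeFlow Sg W} (hF : F.Exact) : (F.uliftFlow).Exact :=
  ⟨fun o k w => hF.future o k w.down, fun o k w => hF.past o k w.down⟩

end TypeFlow

/-! ### Real models from countable bi-relational models -/

open MeasureTheory in
/-- A countable linear order carries a strictly monotone map from its sets of points,
ordered by inclusion, to the unit interval that preserves countable unions and intersections of
lower sets. -/
theorem exists_weight (W : Type*) [LinearOrder W] [Countable W] [Nonempty W] :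
    ∃ g : Set W → unitInterval, g ∅ = 0 ∧ g Set.univ = 1 ∧
      (∀ A B, A ⊂ B → g A < g B) ∧
      (∀ A : ℕ → Set W, (∀ n, IsLowerSet (A n)) → g (⋂ n, A n) = ⨅ n, g (A n)) ∧
      (∀ A : ℕ → Set W, (∀ n, IsLowerSet (A n)) → g (⋃ n, A n) = ⨆ n, g (A n)) := by
  obtain ⟨ε, hε, hsum⟩ := ENNReal.exists_pos_sum_of_countable one_ne_zero W
  have h₀ : ∑' w, (ε w : ENNReal) ≠ 0 := by
    obtain ⟨w⟩ := ‹Nonempty W›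
    exact fun h => (hε w).ne' (by simpa using ENNReal.tsum_eq_zero.1 h w)
  let p : PMF W := PMF.normalize (fun w => (ε w : ENNReal)) h₀ (hsum.trans ENNReal.one_lt_top).ne
  let _ : MeasurableSpace W := ⊤
  let μ : Measure W := p.toMeasure
  have hpos (w : W) : 0 < μ {w} := by
    rw [PMF.toMeasure_apply_singleton _ _ MeasurableSpace.measurableSet_top, pos_iff_ne_zero, ← PMF.mem_support_iff,
      PMF.mem_support_normalize_iff]
    exact_mod_cast (hε w).ne'
  -- Any order isomorphism will do, since Gödel connectives see only the order of the values.
  let e : Set.Iic (1 : ENNReal) ≃o unitInterval :=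
    ENNReal.orderIsoIicOneBirational.symm.trans ENNReal.orderIsoUnitIntervalBirational
  let f : Set W → Set.Iic (1 : ENNReal) := fun A => ⟨μ A, prob_le_one⟩
  have hdir {A : ℕ → Set W} (hA : ∀ n, IsLowerSet (A n)) (n m : ℕ) : A n ⊆ A m ∨ A m ⊆ A n :=
    (hA n).total (hA m)
  refine ⟨fun A => e (f A), ?_, ?_, fun A B h => e.strictMono ?_, fun A hA => ?_, fun A hA => ?_⟩
  · have : f ∅ = ⊥ := Subtype.ext (measure_empty (μ := μ))
    exact (congrArg e this).trans e.map_bot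
  · have : f Set.univ = ⊤ := Subtype.ext (measure_univ (μ := μ))
    exact (congrArg e this).trans e.map_top
  · obtain ⟨hAB, w, hwB, hwA⟩ := Set.ssubset_iff_exists.1 h
    change μ A < μ B
    calc μ A < μ A + μ {w} := ENNReal.lt_add_right (measure_ne_top _ _) (hpos w).ne'
      _ = μ (A ∪ {w}) := (measure_union (Set.disjoint_singleton_right.2 hwA)
          MeasurableSpace.measurableSet_top).symm
      _ ≤ μ B := measure_mono (Set.union_subset hAB (Set.singleton_subset_iff.2 hwB))
  · simp only
    rw [← e.map_iInf]
    congr 1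
    ext
    rw [Set.Iic.coe_iInf]
    -- Infima in `Set.Iic 1` carry a meet with 1, which is harmless as all masses are at most 1.
    change μ _ = 1 ⊓ ⨅ n, μ (A n)
    rw [Directed.measure_iInter (fun n => MeasurableSpace.measurableSet_top.nullMeasurableSet) ?_
      ⟨0, measure_ne_top _ _⟩, inf_eq_right.2 (iInf_le_of_le (0 : ℕ) prob_le_one)]
    intro n m
    exact (hdir hA n m).elim (fun h => ⟨n, subset_rfl, h⟩) fun h => ⟨m, h, subset_rfl⟩
  · simp only
    rw [← e.map_iSup]
    congr 1
    ext
    rw [Set.Iic.coe_iSup]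
    change μ _ = ⨆ n, μ (A n)
    rw [Directed.measure_iUnion]
    intro n m
    exact (hdir hA n m).elim (fun h => ⟨m, h, subset_rfl⟩) fun h => ⟨n, subset_rfl, h⟩

namespace RelValuation

variable {W : Type*} [LinearOrder W] {T : Type*} {S : Equiv.Perm T} (V : RelValuation W S)

/-- The points of `W` at which a formula is true at time `t`. -/
def truthSet (φ : Formula) (t : T) : Set W := {w | (w, t) ∈ V.val φ}

theorem isLowerSet_truthSet (φ : Formula) (t : T) : IsLowerSet (V.truthSet φ t) :=
  fun _ _ h hw => V.down h hw

theorem map_inter_of_lower {g : Set W → unitInterval} (hg : Monotone g) {A B : Set W}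
    (hA : IsLowerSet A) (hB : IsLowerSet B) : g (A ∩ B) = min (g A) (g B) := by
  rcases hA.total hB with h | h
  · rw [Set.inter_eq_left.2 h, min_eq_left (hg h)]
  · rw [Set.inter_eq_right.2 h, min_eq_right (hg h)]

theorem map_union_of_lower {g : Set W → unitInterval} (hg : Monotone g) {A B : Set W}
    (hA : IsLowerSet A) (hB : IsLowerSet B) : g (A ∪ B) = max (g A) (g B) := by
  rcases hA.total hB with h | h
  · rw [Set.union_eq_right.2 h, max_eq_right (hg h)]
  · rw [Set.union_eq_left.2 h, max_eq_left (hg h)]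

theorem map_biInter_of_lower {g : Set W → unitInterval} (hg : Monotone g) (htop : g Set.univ = 1)
    {A : ℕ → Set W} (hA : ∀ n, IsLowerSet (A n)) (n : ℕ) :
    IsLowerSet {w | ∀ k < n, w ∈ A k} ∧
      g {w | ∀ k < n, w ∈ A k} = (Finset.range n).inf fun k => g (A k) := by
  induction n with
  | zero =>
    simp only [not_lt_zero, false_imp_iff, implies_true, Set.ofPred_true, htop]
    exact ⟨isLowerSet_univ, rfl⟩
  | succ n ih =>
    have : {w | ∀ k < n + 1, w ∈ A k} = A n ∩ {w | ∀ k < n, w ∈ A k} := by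
      ext w
      simp only [Nat.forall_lt_succ_right, and_comm (a := ∀ _ < n, _)]
      rfl
    rw [this, Finset.range_add_one, Finset.inf_insert, map_inter_of_lower hg (hA n) ih.1, ih.2]
    exact ⟨(hA n).inter ih.1, rfl⟩

theorem map_until_of_lower {g : Set W → unitInterval} (hg : Monotone g) (htop : g Set.univ = 1)
    (hSup : ∀ A : ℕ → Set W, (∀ n, IsLowerSet (A n)) → g (⋃ n, A n) = ⨆ n, g (A n))
    {A B : ℕ → Set W} (hA : ∀ n, IsLowerSet (A n)) (hB : ∀ n, IsLowerSet (B n)) :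
    g {w | ∃ n, (∀ k < n, w ∈ A k) ∧ w ∈ B n} =
      ⨆ n : ℕ, min ((Finset.range n).inf fun k => g (A k)) (g (B n)) := by
  have h (n : ℕ) := map_biInter_of_lower hg htop hA n
  have : {w | ∃ n, (∀ k < n, w ∈ A k) ∧ w ∈ B n} = ⋃ n, {w | ∀ k < n, w ∈ A k} ∩ B n := by
    ext w
    simp
  rw [this, hSup _ fun n => (h n).1.inter (hB n)]
  simp only [map_inter_of_lower hg (h _).1 (hB _), (h _).2]

theorem map_iInter_of_lower {g : Set W → unitInterval}
    (hInf : ∀ A : ℕ → Set W, (∀ n, IsLowerSet (A n)) → g (⋂ n, A n) = ⨅ n, g (A n))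
    {A : ℕ → Set W} (hA : ∀ n, IsLowerSet (A n)) : g {w | ∀ n, w ∈ A n} = ⨅ n, g (A n) := by
  rw [← hInf A hA]
  congr 1
  ext w
  simp

/-- The value of a formula is the weight of its truth set. Truth sets are pairwise nested, so strict
monotonicity makes comparison of values the same as inclusion of truth sets, which is what both
implications test. -/
theorem exists_realValuation [Countable W] [Nonempty W] :
    ∃ V' : RealValuation S, ∀ φ t, V.truthSet φ t ≠ Set.univ → V'.V φ t ≠ 1 := by
  obtain ⟨g, hbot, htop, hlt, hInf, hSup⟩ := exists_weight W
  have hg : Monotone g := by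
    intro A B h
    rcases h.eq_or_ssubset with rfl | h
    exacts [le_rfl, (hlt _ _ h).le]
  have hlow := V.isLowerSet_truthSet
  have hle {φ ψ t} : g (V.truthSet φ t) ≤ g (V.truthSet ψ t) ↔
      V.truthSet φ t ⊆ V.truthSet ψ t := by
    refine ⟨fun h => ?_, fun h => hg h⟩
    by_contra hn
    have := ((hlow φ t).total (hlow ψ t)).resolve_left hn
    exact (hlt _ _ ⟨this, hn⟩).not_ge h
  refine ⟨{
    V := fun φ t => g (V.truthSet φ t)
    and_eq := fun φ ψ t => ?_
    or_eq := fun φ ψ t => ?_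
    imp_eq := fun φ ψ t => ?_
    coimp_eq := fun φ ψ t => ?_
    X_eq := fun φ t => congrArg g (Set.ext fun w => V.mem_X)
    Y_eq := fun φ t => congrArg g (Set.ext fun w => V.mem_Y)
    G_eq := fun φ t => ?_
    H_eq := fun φ t => ?_
    U_eq := fun φ ψ t => ?_
    S_eq := fun φ ψ t => ?_ }, fun φ t h => ?_⟩
  · rw [← map_inter_of_lower hg (hlow φ t) (hlow ψ t)]
    simp only [truthSet, V.and_eq]
    rfl
  · rw [← map_union_of_lower hg (hlow φ t) (hlow ψ t)]
    simp only [truthSet, V.or_eq]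
    rfl
  · split_ifs with h <;> rw [hle] at h
    · rw [← htop]
      congr 1
      refine Set.eq_univ_of_forall fun w => ?_
      simp only [truthSet, V.imp_eq]
      exact fun v _ hv => h hv
    · have h' := ((hlow φ t).total (hlow ψ t)).resolve_left h
      obtain ⟨u, hu, hu'⟩ := Set.not_subset.1 h
      congr 1
      ext w
      simp only [truthSet, V.imp_eq]
      refine ⟨fun hw => ?_, fun hw v hv _ => V.down hv hw⟩
      -- The point `u` separates: at or above it the implication fails, and below it `φ` is true, so
      -- the implication amounts to `ψ`.
      rcases le_total u w with huw | huw
      · exact absurd (hw u huw hu) hu'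
      · exact hw w le_rfl (V.down huw hu)
  · split_ifs with h <;> rw [hle] at h
    · rw [← hbot]
      congr 1
      refine Set.eq_empty_of_forall_notMem fun w hw => ?_
      simp only [truthSet, V.coimp_eq] at hw
      obtain ⟨v, -, h₁, h₂⟩ := hw
      exact h₂ (h h₁)
    · obtain ⟨u, hu, hu'⟩ := Set.not_subset.1 h
      congr 1
      ext w
      simp only [truthSet, V.coimp_eq]
      constructor
      · rintro ⟨v, hv, h₁, -⟩
        exact V.down hv h₁
      · intro hw
        rcases le_total u w with huw | huw
        · exact ⟨w, le_rfl, hw, fun h' => hu' (V.down huw h')⟩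
        · exact ⟨u, huw, hu, hu'⟩
  · rw [← map_iInter_of_lower hInf fun n => hlow φ ((S ^ n) t)]
    exact congrArg g (Set.ext fun w => V.mem_G)
  · rw [← map_iInter_of_lower hInf fun n => hlow φ ((S⁻¹ ^ n) t)]
    exact congrArg g (Set.ext fun w => V.mem_H)
  · rw [← map_until_of_lower hg htop hSup (fun n => hlow φ ((S ^ n) t))
      fun n => hlow ψ ((S ^ n) t)]
    exact congrArg g (Set.ext fun w => V.mem_U)
  · rw [← map_until_of_lower hg htop hSup (fun n => hlow φ ((S⁻¹ ^ n) t))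
      fun n => hlow ψ ((S⁻¹ ^ n) t)]
    exact congrArg g (Set.ext fun w => V.mem_S)
  · exact ((hlt _ _ (Set.ssubset_univ_iff.2 h)).trans_eq htop).ne

end RelValuation

/-! ### Falsifiability -/

section Falsifiability

variable {φ : Formula} {Sg : Set Formula} (hfin : Sg.Finite) (hsub : SubformulaClosed Sg)
include hfin hsub

theorem RealFalsifiable.nonempty_smallWitness (h : RealFalsifiable.{u} φ) :
    Nonempty (SmallWitness Sg φ) := by
  simp only [RealFalsifiable, RealValid] at h
  push Not at h
  obtain ⟨T, S, V, t, ht⟩ := h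
  -- At threshold 1, membership of `φ` in the type means that its value is 1.
  refine (V.typeFlow hsub t).nonempty_smallWitness hfin (V.typeFlow_realising hsub hfin t)
    (w₀ := ⟨1, Set.mem_Ioi.2 zero_lt_one⟩) fun h => ht ?_
  exact le_antisymm unitInterval.le_one' h.2

theorem RelFalsifiable.nonempty_smallWitness (h : RelFalsifiable.{v, w} φ) :
    Nonempty (SmallWitness Sg φ) := by
  simp only [RelFalsifiable, RelValid] at h
  push Not at h
  obtain ⟨W, _, T, S, V, h⟩ := h
  obtain ⟨⟨w, t⟩, hwt⟩ := (Set.ne_univ_iff_exists_notMem _).1 h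
  exact (V.typeFlow hsub t).nonempty_smallWitness hfin (V.typeFlow_realising hsub t)
    (w₀ := w) fun h => hwt h.2

theorem SmallWitness.relFalsifiable (hφ : φ ∈ Sg) (x : SmallWitness Sg φ) : RelFalsifiable.{v, w} φ := by
  obtain ⟨W, _, _, F, hF, w₀, hw₀⟩ := x.exists_typeFlow hfin
  intro hvalid
  have h : ((⟨w₀⟩, ⟨0⟩) : ULift.{v} W × ULift.{w} ℤ) ∈ F.uliftFlow.relValuation.val φ := by
    rw [hvalid]
    trivial
  exact hw₀ ((F.uliftFlow.mem_relValuation_iff hsub hF.uliftFlow hφ _ _).1 h)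

theorem SmallWitness.realFalsifiable (hφ : φ ∈ Sg) (x : SmallWitness Sg φ) : RealFalsifiable.{u} φ := by
  obtain ⟨W, _, _, F, hF, w₀, hw₀⟩ := x.exists_typeFlow hfin
  have : Nonempty W := ⟨w₀⟩
  obtain ⟨V, hV⟩ := (F.relValuation.{u}).exists_realValuation
  refine fun hvalid => hV φ ⟨0⟩ (fun h => ?_) (hvalid _ _ V _)
  exact hw₀ ((F.mem_relValuation_iff hsub hF hφ w₀ ⟨0⟩).1 (Set.eq_univ_iff_forall.1 h w₀))

end Falsifiability

end GTL

theorem mainTheorem7 (φ : GTL.Formula) (Sg : Set GTL.Formula) (hfin : Sg.Finite)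
    (hsub : GTL.SubformulaClosed Sg) (hφ : φ ∈ Sg) :
    (GTL.RealFalsifiable.{u} φ ↔ Nonempty (GTL.SmallWitness Sg φ)) ∧
    (GTL.RelFalsifiable.{v, w} φ ↔ Nonempty (GTL.SmallWitness Sg φ)) :=
  ⟨⟨fun h => h.nonempty_smallWitness hfin hsub, fun ⟨x⟩ => x.realFalsifiable hfin hsub hφ⟩,
    fun h => h.nonempty_smallWitness hfin hsub, fun ⟨x⟩ => x.relFalsifiable hfin hsub hφ⟩
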